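/- **Setting.** Let $\theta$ be an irrational real number. The one-sided Sturmian subshift $\Xi=\Xi_\theta\subset\{0,1\}^{\mathbb N}$ of slope $\theta$ is the closure (for pointwise convergence) of the set of sequences $s_\rho$, $\rho\in\mathbb R$, with $s_\rho(n)=\lfloor (n+1)\theta+\rho\rfloor-\lfloor n\theta+\rho\rfloor-\lfloor\theta\rfloor$. Its language $\mathcal L$ is the set of finite words occurring in sequences of $\Xi$; $|u|$ is the length of a word $u$. *Privileged edges.* A word $v$ is a complete first return to a word $u$ if $u$ occurs exactly twice in $v$, once as a prefix and once as a suffix (by convention, the complete first returns to the empty word are the letters). The empty word is privileged, and every complete first return to a privileged word is privileged. Let $\mathcal H$ be the set of ordered pairs $h=(v,v')$ of distinct words of $\mathcal L$ that are both complete first returns to one privileged word $u$ (which is determined by the pair: it is the longest common privileged prefix of $v$ and $v'$). Put $s(h)=v$, $h^{op}=(v',v)$. *Length function.* Let $\delta:[0,\infty)\to(0,\infty)$ be strictly decreasing with $\delta(r)\to0$ as $r\to\infty$, and suppose that there are constants $\bar c,\underline c>0$ such that $\delta(ab)\le\bar c\,\delta(a)\delta(b)$ and $\delta(2a)\ge\underline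 c\,\delta(a)$ for all sufficiently large $a,b$. The length of the edge $h=(v,v')$ above is $\delta(h):=\delta(|u|)$. *Choice functions and Connes distances.* A choice function is a map $\tau:\mathcal L\to\Xi$ such that $v$ is a prefix of $\tau(v)$ for every $v$, and, whenever $w$ is a proper prefix of $v\in\mathcal L$, $\tau(w)=\tau(v)$ if and only if $v$ is a prefix of $\tau(w)$. For a choice function $\tau$ represent $f\in C(\Xi)$ on $\ell^2(\mathcal H)$ by $(\pi_\tau(f)\psi)(h)=f(\tau(s(h)))\psi(h)$, let $D$ be the self-adjoint operator $(D\psi)(h)=\delta(h)^{-1}\psi(h^{op})$ with domain $\{\psi\in\ell^2(\mathcal H):D\psi\in\ell^2(\mathcal H)\}$, and put $$d_\tau(\xi,\eta)=\sup\{|f(\xi)-f(\eta)|:\ f\in C(\Xi),\ \|[D,\pi_\tau(f)]\|\le1\}\in[0,\infty].$$ Let $d_{\inf}=\inf_\tau d_\tau$ and $d_{\sup}=\sup_\tau d_\tau$, over all choice functions. **Statement.** The following are equivalent: 1. $\Xi$ is linearly repetitive: there is a constant $C$ such that, for every $n$, every word of $\mathcal L$ of length at least $Cn$ contains every word of $\mathcal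 L$ of length $n$; 2. the continued fraction expansion of $\theta$ has bounded coefficients; 3. $d_{\inf}$ and $d_{\sup}$ are Lipschitz-equivalent: there is a constant $C>0$ with $C^{-1}d_{\inf}(\xi,\eta)\le d_{\sup}(\xi,\eta)\le C\,d_{\inf}(\xi,\eta)$ for all $\xi,\eta\in\Xi$. -/

import Mathlib

open Filter Topology
open scoped ENNReal NNReal
open SymbolicDynamics.FullShift (Subshift shift)

noncomputable section

namespace ConnesSubshift

/-! ### Words, language, linear repetitiveness -/

section Words

variable {A : Type*}

/-- The factor `x_n x_{n+1} ⋯ x_{n+l-1}` of the sequence `x`. -/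
def factor (x : ℕ → A) (n l : ℕ) : List A :=
  (List.range l).map fun i => x (n + i)

/-- The word `w` is a prefix of the sequence `x`. -/
def IsPrefixOfSeq (w : List A) (x : ℕ → A) : Prop :=
  factor x 0 w.length = w

/-- The positions at which `u` occurs in `v`. -/
def occurrences (u v : List A) : Set ℕ :=
  {i | i ≤ v.length ∧ u <+: v.drop i}

/-- `v` is a complete first return to `u`: the word `u` occurs exactly twice in `v`, once as a
prefix and once as a suffix. The empty word occurs at the `|v| + 1` positions `0, …, |v|` of `v`,
so the complete first returns to the empty word are exactly the letters. -/
def IsCompleteFirstReturn (u v : List A) : Prop :=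
  u <+: v ∧ u <:+ v ∧ (occurrences u v).ncard = 2

/-- Privileged words: the empty word is privileged, and so is every complete first return to a
privileged word. -/
inductive IsPrivileged : List A → Prop
  | nil : IsPrivileged []
  | step (u v : List A) : IsPrivileged u → IsCompleteFirstReturn u v → IsPrivileged v

variable [TopologicalSpace A]

/-- The language of a one-sided subshift: all finite words occurring in its sequences. These words
are the vertices of the tree of words, ordered by the prefix relation. -/
def language (X : Subshift A ℕ) : Set (List A) :=
  {w | ∃ x ∈ X.carrier, ∃ n, factor x n w.length = w}

/-- There is a constant `C` such that every word of length at least `C n` of the language contains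
every word of length `n` of the language. -/
def IsLinearlyRepetitive (X : Subshift A ℕ) : Prop :=
  ∃ C : ℝ, ∀ u ∈ language X, ∀ w ∈ language X, C * u.length ≤ w.length → u <:+: w

end Words

/-! ### The spectral triple with privileged horizontal edges -/

section SpectralTriple

variable {A : Type*} [TopologicalSpace A]

/-- The privileged horizontal edges: ordered pairs `(src, tgt)` of distinct complete first returns,
in the language, to a common privileged word `base`. The word `base` is determined by the pair:
it is the longest privileged word that is a common prefix of `src` and `tgt`. -/
structure PrivilegedEdge (X : Subshift A ℕ) where
  base : List A
  src : List A
  tgt : List A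
  base_privileged : IsPrivileged base
  src_mem : src ∈ language X
  tgt_mem : tgt ∈ language X
  src_return : IsCompleteFirstReturn base src
  tgt_return : IsCompleteFirstReturn base tgt
  src_ne_tgt : src ≠ tgt

/-- The edge with the opposite orientation. -/
def PrivilegedEdge.op {X : Subshift A ℕ} (h : PrivilegedEdge X) : PrivilegedEdge X where
  base := h.base
  src := h.tgt
  tgt := h.src
  base_privileged := h.base_privileged
  src_mem := h.tgt_mem
  tgt_mem := h.src_mem
  src_return := h.tgt_return
  tgt_return := h.src_return
  src_ne_tgt := h.src_ne_tgt.symm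

/-- The length of a privileged edge. -/
def PrivilegedEdge.len {X : Subshift A ℕ} (δ : ℝ → ℝ) (h : PrivilegedEdge X) : ℝ :=
  δ (h.base.length : ℝ)

/-- A choice function on the tree of words. The boundary of the tree is identified with the
subshift space, an infinite path passing through a vertex `v` iff the sequence has prefix `v`. -/
structure ChoiceFunction (X : Subshift A ℕ) where
  toFun : language X → X.carrier
  isPrefix : ∀ v, IsPrefixOfSeq v.1 (toFun v).1
  coherent : ∀ w v : language X, w.1 <+: v.1 → w ≠ v →
    (toFun w = toFun v ↔ IsPrefixOfSeq v.1 (toFun w).1)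

/-- The Hilbert space `ℓ²` over the privileged edges. -/
abbrev EdgeSpace (X : Subshift A ℕ) : Type _ :=
  lp (fun _ : PrivilegedEdge X => ℂ) 2

/-- The Dirac operator `(D ψ)(h) = δ(h)⁻¹ ψ(hᵒᵖ)`, with its maximal domain
`{ψ ∈ ℓ² : D ψ ∈ ℓ²}`. -/
def dirac (X : Subshift A ℕ) (δ : ℝ → ℝ) : EdgeSpace X →ₗ.[ℂ] EdgeSpace X where
  domain :=
    { carrier := {ψ | Memℓp (fun h : PrivilegedEdge X => ((h.len δ : ℂ))⁻¹ * ψ h.op) 2}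
      zero_mem' := by
        have : (fun h : PrivilegedEdge X =>
            ((h.len δ : ℂ))⁻¹ * (0 : EdgeSpace X) h.op) = 0 := by
          ext h; simp
        change Memℓp _ 2
        rw [this]
        exact zero_memℓp
      add_mem' := by
        intro a b ha hb
        have : (fun h : PrivilegedEdge X => ((h.len δ : ℂ))⁻¹ * (a + b) h.op) =
            (fun h : PrivilegedEdge X => ((h.len δ : ℂ))⁻¹ * a h.op) +
            (fun h : PrivilegedEdge X => ((h.len δ : ℂ))⁻¹ * b h.op) := by
          ext h; simp [mul_add]
        change Memℓp _ 2
        rw [this]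
        exact Memℓp.add ha hb
      smul_mem' := by
        intro c a ha
        have : (fun h : PrivilegedEdge X => ((h.len δ : ℂ))⁻¹ * (c • a) h.op) =
            c • (fun h : PrivilegedEdge X => ((h.len δ : ℂ))⁻¹ * a h.op) := by
          ext h; simp [mul_left_comm]
        change Memℓp _ 2
        rw [this]
        exact Memℓp.const_smul ha c }
  toFun :=
    { toFun := fun ψ => ⟨fun h => ((h.len δ : ℂ))⁻¹ * ψ.1 h.op, ψ.2⟩
      map_add' := by
        intro a b
        ext h
        simp [mul_add]
        rfl
      map_smul' := by
        intro c a
        ext h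
        simp [mul_left_comm] }

/-- A subshift over a finite alphabet is compact. -/
instance [Finite A] (X : Subshift A ℕ) : CompactSpace X.carrier :=
  isCompact_iff_compactSpace.mp X.isClosed.isCompact

variable [Finite A]

/-- The representation `(π_τ(f) ψ)(h) = f(τ(s(h))) ψ(h)` of `C(X)` on `ℓ²`. -/
def rep {X : Subshift A ℕ} (τ : ChoiceFunction X) (f : C(X.carrier, ℂ)) (ψ : EdgeSpace X) :
    EdgeSpace X :=
  ⟨fun h => f (τ.toFun ⟨h.src, h.src_mem⟩) * ψ h, by
    refine Memℓp.mono' (lp.memℓp ((‖f‖ : ℂ) • ψ)) fun h => ?_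
    simp only [lp.coeFn_smul, Pi.smul_apply, smul_eq_mul, norm_mul, Complex.norm_real, norm_norm]
    gcongr
    exact f.norm_coe_le_norm _⟩

/-- `‖[D, π_τ(f)]‖ ≤ 1`: the commutator is defined on the domain of `D` and extends to an operator
of norm at most `1`. -/
def CommutatorNormLEOne {X : Subshift A ℕ} (δ : ℝ → ℝ) (τ : ChoiceFunction X)
    (f : C(X.carrier, ℂ)) : Prop :=
  ∀ ψ : (dirac X δ).domain, ∃ hψ : rep τ f ψ.1 ∈ (dirac X δ).domain,
    ‖dirac X δ ⟨rep τ f ψ.1, hψ⟩ - rep τ f (dirac X δ ψ)‖ ≤ ‖ψ.1‖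

/-- The Connes distance `d_τ(ξ, η) = sup {|f(ξ) - f(η)| : f ∈ C(X), ‖[D, π_τ(f)]‖ ≤ 1}`, with
values in `[0, ∞]`. -/
def connesDist {X : Subshift A ℕ} (δ : ℝ → ℝ) (τ : ChoiceFunction X) (ξ η : X.carrier) : ℝ≥0∞ :=
  ⨆ (f : C(X.carrier, ℂ)) (_ : CommutatorNormLEOne δ τ f), ‖f ξ - f η‖ₑ

/-- The infimum of the Connes distances over all choice functions. -/
def dInf (X : Subshift A ℕ) (δ : ℝ → ℝ) (ξ η : X.carrier) : ℝ≥0∞ :=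
  ⨅ τ : ChoiceFunction X, connesDist δ τ ξ η

/-- The supremum of the Connes distances over all choice functions. -/
def dSup (X : Subshift A ℕ) (δ : ℝ → ℝ) (ξ η : X.carrier) : ℝ≥0∞ :=
  ⨆ τ : ChoiceFunction X, connesDist δ τ ξ η

end SpectralTriple

/-- Lipschitz equivalence of two `[0, ∞]`-valued distance functions. -/
def LipschitzEquivalent {Y : Type*} (d d' : Y → Y → ℝ≥0∞) : Prop :=
  ∃ C : ℝ≥0, 0 < C ∧ ∀ x y, (C : ℝ≥0∞)⁻¹ * d x y ≤ d' x y ∧ d' x y ≤ (C : ℝ≥0∞) * d x y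

/-- The function `δ : [0, ∞) → (0, ∞)` is strictly decreasing and tends to `0` at infinity. -/
structure IsLengthFunction (δ : ℝ → ℝ) : Prop where
  pos : ∀ a, 0 ≤ a → 0 < δ a
  strictAnti : StrictAntiOn δ (Set.Ici 0)
  tendsto : Tendsto δ atTop (𝓝 0)

/-- `δ(ab) ≤ c̄ δ(a) δ(b)` and `δ(2a) ≥ c̲ δ(a)` for some constants `c̄, c̲ > 0` and all large
`a`, `b`. -/
def SatisfiesMultiplicativeInequalities (δ : ℝ → ℝ) : Prop :=
  (∃ c > 0, ∃ R : ℝ, ∀ a ≥ R, ∀ b ≥ R, δ (a * b) ≤ c * δ a * δ b) ∧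
  (∃ c > 0, ∃ R : ℝ, ∀ a ≥ R, c * δ a ≤ δ (2 * a))

/-! ### Sturmian subshifts -/

/-- The mechanical word of slope `θ` and intercept `ρ`: the `n`-th letter is `1` or `0` (that is,
`true` or `false`) according as the increment `⌊(n+1)θ + ρ⌋ - ⌊nθ + ρ⌋` is `⌊θ⌋ + 1` or `⌊θ⌋`. -/
def mechanicalWord (θ ρ : ℝ) (n : ℕ) : Bool :=
  decide (⌊((n : ℝ) + 1) * θ + ρ⌋ - ⌊(n : ℝ) * θ + ρ⌋ = ⌊θ⌋ + 1)

/-- The one-sided Sturmian subshift of (irrational) slope `θ`: the closure in `{0,1}^ℕ` of the set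
of all mechanical words of slope `θ`. -/
def sturmianSubshift (θ : ℝ) : Subshift Bool ℕ where
  carrier := closure (Set.range (mechanicalWord θ))
  isClosed := isClosed_closure
  mapsTo g := by
    refine Set.MapsTo.closure ?_ (SymbolicDynamics.FullShift.continuous_shift g)
    rintro _ ⟨ρ, rfl⟩
    refine ⟨(g : ℝ) * θ + ρ, ?_⟩
    funext n
    simp only [mechanicalWord, SymbolicDynamics.FullShift.shift_apply, Nat.cast_add]
    rw [show ((g : ℝ) + n + 1) * θ + ρ = ((n : ℝ) + 1) * θ + (g * θ + ρ) by ring,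
      show ((g : ℝ) + n) * θ + ρ = (n : ℝ) * θ + (g * θ + ρ) by ring]

/-- The coefficients `a₁, a₂, …` of the regular continued fraction `[a₀; a₁, a₂, …]` of `θ` are
bounded. -/
def HasBoundedCoefficients (θ : ℝ) : Prop :=
  ∃ B : ℝ, ∀ (n : ℕ) (b : ℝ), (GenContFract.of θ).partDens.get? n = some b → b ≤ B

end ConnesSubshift

end

noncomputable section

namespace ConnesSubshift

section WordLemmas

variable {A : Type*}

@[simp] theorem length_factor (x : ℕ → A) (n l : ℕ) : (factor x n l).length = l := by
  simp [factor]

@[simp] theorem getElem_factor (x : ℕ → A) (n l i : ℕ) (h : i < (factor x n l).length) :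
    (factor x n l)[i] = x (n + i) := by
  simp [factor]

theorem factor_eq_iff {x y : ℕ → A} {n m l : ℕ} :
    factor x n l = factor y m l ↔ ∀ i < l, x (n + i) = y (m + i) := by
  constructor
  · intro h i hi
    have := List.getElem_of_eq h (i := i) (by simpa using hi)
    simpa using this
  · intro h
    refine List.ext_getElem (by simp) fun i h1 _ => ?_
    simpa using h i (by simpa using h1)

theorem isPrefixOfSeq_iff {w : List A} {x : ℕ → A} :
    IsPrefixOfSeq w x ↔ ∀ (i : ℕ) (h : i < w.length), x i = w[i] := by
  unfold IsPrefixOfSeq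
  constructor
  · intro h i hi
    have := List.getElem_of_eq h (i := i) (by simpa using hi)
    simpa using this
  · intro h
    refine List.ext_getElem (by simp) fun i h1 h2 => ?_
    simpa using h i h2

theorem isPrefixOfSeq_factor {x y : ℕ → A} {n l : ℕ} :
    IsPrefixOfSeq (factor x n l) y ↔ ∀ i < l, y i = x (n + i) := by
  simp [isPrefixOfSeq_iff]

theorem isPrefixOfSeq_factor_self (x : ℕ → A) (l : ℕ) : IsPrefixOfSeq (factor x 0 l) x := by
  simp [isPrefixOfSeq_factor]

theorem isPrefixOfSeq_factor_mono {x y : ℕ → A} {l m : ℕ} (hlm : l ≤ m)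
    (h : IsPrefixOfSeq (factor x 0 m) y) : IsPrefixOfSeq (factor x 0 l) y := by
  rw [isPrefixOfSeq_factor] at h ⊢
  exact fun i hi => h i (by omega)

theorem factor_append_singleton (x : ℕ → A) (n l : ℕ) :
    factor x n l ++ [x (n + l)] = factor x n (l + 1) := by
  simp [factor, List.range_succ]

theorem take_factor (x : ℕ → A) (n m i : ℕ) (h : i ≤ m) :
    (factor x n m).take i = factor x n i := by
  refine List.ext_getElem (by simp [h]) fun j h1 h2 => ?_
  simp

theorem drop_factor (x : ℕ → A) (n m i : ℕ) :
    (factor x n m).drop i = factor x (n + i) (m - i) := by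
  refine List.ext_getElem (by simp) fun j h1 h2 => ?_
  simp [add_assoc]

theorem prefix_factor_iff {u : List A} {x : ℕ → A} {n m : ℕ} :
    u <+: factor x n m ↔ u.length ≤ m ∧ factor x n u.length = u := by
  constructor
  · intro h
    have hl : u.length ≤ m := by simpa using h.length_le
    refine ⟨hl, ?_⟩
    rw [← take_factor x n m _ hl]
    exact (List.prefix_iff_eq_take.mp h).symm
  · rintro ⟨hl, h⟩
    rw [List.prefix_iff_eq_take, take_factor _ _ _ _ hl, h]

theorem IsPrefixOfSeq.prefix_of_length_le {u v : List A} {x : ℕ → A} (hu : IsPrefixOfSeq u x)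
    (hv : IsPrefixOfSeq v x) (h : u.length ≤ v.length) : u <+: v := by
  rw [← (hv : factor x 0 v.length = v), prefix_factor_iff]
  exact ⟨h, hu⟩

theorem IsPrefixOfSeq.of_prefix {u v : List A} {x : ℕ → A} (hv : IsPrefixOfSeq v x)
    (h : u <+: v) : IsPrefixOfSeq u x := by
  rw [← (hv : factor x 0 v.length = v), prefix_factor_iff] at h
  exact h.2

theorem factor_prefix_factor (x : ℕ → A) (n : ℕ) {l m : ℕ} (h : l ≤ m) :
    factor x n l <+: factor x n m := by
  rw [prefix_factor_iff]; simp [h]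

theorem factor_infix_factor (x : ℕ → A) {n m l N : ℕ} (h1 : n ≤ m) (h2 : m + l ≤ n + N) :
    factor x m l <:+: factor x n N := by
  have : factor x m l <+: (factor x n N).drop (m - n) := by
    rw [drop_factor, show n + (m - n) = m by omega]
    exact factor_prefix_factor _ _ (by omega)
  exact this.isInfix.trans (List.drop_suffix _ _).isInfix

theorem infix_factor {u : List A} {x : ℕ → A} {n N : ℕ} (h : u <:+: factor x n N) :
    ∃ i, i + u.length ≤ N ∧ factor x (n + i) u.length = u := by
  obtain ⟨s, t, hst⟩ := h
  have h1 : u <+: (factor x n N).drop s.length := by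
    rw [← hst]; simp
  rw [drop_factor, prefix_factor_iff] at h1
  have h2 := congrArg List.length hst
  simp at h2
  exact ⟨s.length, by omega, h1.2⟩

/-- A complete first return is a strictly longer word, beginning and ending with the given word,
in which that word does not occur anywhere else. -/
theorem isCompleteFirstReturn_iff {u v : List A} :
    IsCompleteFirstReturn u v ↔ u <+: v ∧ u <:+ v ∧ u.length < v.length ∧
      ∀ i, 0 < i → i < v.length - u.length → ¬ u <+: v.drop i := by
  have key : u <+: v → u <:+ v → u.length < v.length →
      ({0, v.length - u.length} : Set ℕ) ⊆ occurrences u v := by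
    rintro h1 h2 h3 i (rfl | rfl)
    · exact ⟨by omega, by simpa using h1⟩
    · exact ⟨by omega, by rw [← List.suffix_iff_eq_drop.mp h2]⟩
  have fin : (occurrences u v).Finite := (Set.finite_Iic v.length).subset fun i hi => hi.1
  constructor
  · rintro ⟨h1, h2, h3⟩
    have hlt : u.length < v.length := by
      refine lt_of_le_of_ne h1.length_le fun he => ?_
      have : occurrences u v ⊆ {0} := by
        rintro i ⟨hiv, hi⟩
        have hl := hi.length_le
        simp at hl
        rw [Set.mem_singleton_iff]
        omega
      have := Set.ncard_le_ncard this
      rw [h3] at this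
      simp at this
    refine ⟨h1, h2, hlt, fun i hi0 hi hp => ?_⟩
    have hsub : ({i, 0, v.length - u.length} : Set ℕ) ⊆ occurrences u v := by
      rintro j (rfl | hj)
      · exact ⟨by omega, hp⟩
      · exact key h1 h2 hlt hj
    have := Set.ncard_le_ncard hsub fin
    rw [h3, Set.ncard_insert_of_notMem, Set.ncard_pair] at this
    · omega
    · omega
    · simp; omega
  · rintro ⟨h1, h2, h3, h4⟩
    refine ⟨h1, h2, ?_⟩
    have : occurrences u v = {0, v.length - u.length} := by
      refine Set.Subset.antisymm ?_ (key h1 h2 h3)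
      rintro i ⟨hi, hp⟩
      have hl := hp.length_le
      simp at hl
      simp only [Set.mem_insert_iff, Set.mem_singleton_iff]
      by_contra! hcon
      exact h4 i (by omega) (by omega) hp
    rw [this, Set.ncard_pair]
    omega

theorem IsCompleteFirstReturn.length_lt {u v : List A} (h : IsCompleteFirstReturn u v) :
    u.length < v.length := (isCompleteFirstReturn_iff.mp h).2.2.1

/-- Comparable complete first returns to the same word agree. -/
theorem IsCompleteFirstReturn.eq_of_prefix {u v w : List A} (hv : IsCompleteFirstReturn u v)
    (hw : IsCompleteFirstReturn u w) (h : v <+: w) : v = w := by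
  refine h.eq_of_length_le ?_
  by_contra! hlt
  obtain ⟨-, v2, v3, -⟩ := isCompleteFirstReturn_iff.mp hv
  refine (isCompleteFirstReturn_iff.mp hw).2.2.2 (v.length - u.length) (by omega) (by omega) ?_
  have h1 : v.drop (v.length - u.length) <+: w.drop (v.length - u.length) := h.drop _
  rwa [← List.suffix_iff_eq_drop.mp v2] at h1

theorem IsPrivileged.length_le_aux (n : ℕ) : ∀ b v u : List A, b.length + v.length ≤ n →
    IsPrivileged b → IsPrivileged u → IsCompleteFirstReturn u v → b <+: v →
    b.length < v.length → b.length ≤ u.length := by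
  induction n with
  | zero => intro b v u h _ _ _ _ h'; omega
  | succ n ih =>
    intro b v u hn hb hu huv hbv hlt
    cases hb with
    | nil => simp
    | step b' _ hb' hbb =>
      have l1 := hbb.length_lt
      have l2 := huv.length_lt
      have h1 := ih b' v u (by omega) hb' hu huv (hbb.1.trans hbv) (by omega)
      by_contra! hcon
      have hub : u <+: b := List.prefix_of_prefix_length_le huv.1 hbv hcon.le
      have h2 := ih u b b' (by omega) hu hb' hbb hub hcon
      have : b' = u :=
        (List.prefix_of_prefix_length_le (hbb.1.trans hbv) huv.1 h1).eq_of_length_le h2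
      subst this
      have := hbb.eq_of_prefix huv hbv
      rw [this] at hlt
      exact lt_irrefl _ hlt

/-- The privileged prefixes of a word form a chain for complete first returns. -/
theorem IsPrivileged.length_le {b v u : List A} (hb : IsPrivileged b) (hu : IsPrivileged u)
    (huv : IsCompleteFirstReturn u v) (hbv : b <+: v) (hlt : b.length < v.length) :
    b.length ≤ u.length :=
  IsPrivileged.length_le_aux _ b v u le_rfl hb hu huv hbv hlt

theorem isCompleteFirstReturn_factor {x : ℕ → A} {l r : ℕ} (hr : 0 < r)
    (h : factor x r l = factor x 0 l)
    (hmin : ∀ i, 0 < i → i < r → factor x i l ≠ factor x 0 l) :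
    IsCompleteFirstReturn (factor x 0 l) (factor x 0 (r + l)) := by
  rw [isCompleteFirstReturn_iff]
  refine ⟨factor_prefix_factor _ _ (by omega), ?_, by simpa using hr, fun i h0 hi hp => ?_⟩
  · rw [List.suffix_iff_eq_drop, drop_factor]
    simp [h]
  · rw [drop_factor, prefix_factor_iff] at hp
    simp only [length_factor, zero_add] at hp hi
    exact hmin i h0 (by omega) hp.2

/-- If the prefix `u` of `x` recurs in `x`, then some prefix of `x` is a complete first return
to `u`. -/
theorem exists_isCompleteFirstReturn_factor {x : ℕ → A} {l : ℕ}
    (h : ∃ r, 0 < r ∧ factor x r l = factor x 0 l) :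
    ∃ r, 0 < r ∧ factor x r l = factor x 0 l ∧ (∀ s, 0 < s → factor x s l = factor x 0 l → r ≤ s) ∧
      IsCompleteFirstReturn (factor x 0 l) (factor x 0 (r + l)) := by
  classical
  refine ⟨Nat.find h, (Nat.find_spec h).1, (Nat.find_spec h).2, fun s h1 h2 => Nat.find_min' h ⟨h1, h2⟩,
    isCompleteFirstReturn_factor (Nat.find_spec h).1 (Nat.find_spec h).2 fun i h0 hi he => ?_⟩
  exact Nat.find_min h hi ⟨h0, he⟩

end WordLemmas

section LanguageLemmas

variable {A : Type*} [TopologicalSpace A]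

theorem shift_mem {X : Subshift A ℕ} {x : ℕ → A} (hx : x ∈ X.carrier) (n : ℕ) :
    (fun i => x (n + i)) ∈ X.carrier := X.mapsTo n hx

theorem factor_mem_language {X : Subshift A ℕ} {x : ℕ → A} (hx : x ∈ X.carrier) (n l : ℕ) :
    factor x n l ∈ language X := ⟨x, hx, n, by simp⟩

theorem mem_language_iff {X : Subshift A ℕ} {w : List A} :
    w ∈ language X ↔ ∃ x ∈ X.carrier, IsPrefixOfSeq w x := by
  constructor
  · rintro ⟨x, hx, n, h⟩
    refine ⟨_, shift_mem hx n, ?_⟩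
    rw [← h, isPrefixOfSeq_factor]
    simp
  · rintro ⟨x, hx, h⟩
    exact ⟨x, hx, 0, h⟩

theorem mem_language_of_isPrefixOfSeq {X : Subshift A ℕ} {w : List A} {x : ℕ → A}
    (hx : x ∈ X.carrier) (h : IsPrefixOfSeq w x) : w ∈ language X :=
  mem_language_iff.mpr ⟨x, hx, h⟩

/-- A sequence all of whose prefixes belong to the language belongs to the subshift. -/
theorem mem_carrier_of_factor_mem_language [DiscreteTopology A] {X : Subshift A ℕ} {x : ℕ → A}
    (h : ∀ l, factor x 0 l ∈ language X) : x ∈ X.carrier := by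
  rw [← X.isClosed.closure_eq]
  choose y hy hyx using fun l => mem_language_iff.mp (h l)
  refine mem_closure_of_tendsto (f := y) (b := atTop) ?_ (Eventually.of_forall hy)
  rw [tendsto_pi_nhds]
  intro i
  refine tendsto_const_nhds.congr' ?_
  filter_upwards [eventually_gt_atTop i] with l hl
  have := isPrefixOfSeq_factor.mp (hyx l) i hl
  simp [this]

end LanguageLemmas

section Commutator

variable {A : Type*} [TopologicalSpace A]

theorem PrivilegedEdge.op_op {X : Subshift A ℕ} (h : PrivilegedEdge X) : h.op.op = h := rfl

theorem PrivilegedEdge.op_injective {X : Subshift A ℕ} :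
    Function.Injective (PrivilegedEdge.op : PrivilegedEdge X → PrivilegedEdge X) :=
  Function.Involutive.injective PrivilegedEdge.op_op

theorem PrivilegedEdge.len_pos {X : Subshift A ℕ} {δ : ℝ → ℝ} (hδ : IsLengthFunction δ)
    (h : PrivilegedEdge X) : 0 < h.len δ := hδ.pos _ (Nat.cast_nonneg _)

variable [Finite A]

/-- The commutator with `π_τ(f)` has norm at most `1` iff `f ∘ τ` does not vary along any edge by
more than the length of the edge. -/
theorem commutatorNormLEOne_iff {X : Subshift A ℕ} {δ : ℝ → ℝ} (hδ : IsLengthFunction δ)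
    {τ : ChoiceFunction X} {f : C(X.carrier, ℂ)} :
    CommutatorNormLEOne δ τ f ↔ ∀ h : PrivilegedEdge X,
      ‖f (τ.toFun ⟨h.src, h.src_mem⟩) - f (τ.toFun ⟨h.tgt, h.tgt_mem⟩)‖ ≤ h.len δ := by
  constructor
  · intro H h
    classical
    set ψ : EdgeSpace X := lp.single 2 h.op (1 : ℂ) with hψdef
    have hdom : ψ ∈ (dirac X δ).domain := by
      have : (fun k : PrivilegedEdge X => ((k.len δ : ℂ))⁻¹ * ψ k.op) =
          ⇑(lp.single 2 h ((h.len δ : ℂ)⁻¹) : EdgeSpace X) := by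
        ext k
        by_cases hk : k = h
        · subst hk; simp [hψdef]
        · have hk' : k.op ≠ h.op := fun e => hk (PrivilegedEdge.op_injective e)
          simp [hψdef, hk, hk']
      change Memℓp (fun k : PrivilegedEdge X => ((k.len δ : ℂ))⁻¹ * ψ k.op) 2
      rw [this]
      exact lp.memℓp _
    obtain ⟨h1, h2⟩ := H ⟨ψ, hdom⟩
    have h3 := (lp.norm_apply_le_norm (by norm_num) _ h).trans h2
    have h4 : ‖ψ‖ = 1 := by
      rw [hψdef, lp.norm_single (by norm_num)]; simp
    rw [h4] at h3
    have h5 : (dirac X δ ⟨rep τ f ψ, h1⟩ - rep τ f (dirac X δ ⟨ψ, hdom⟩)) h =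
        (h.len δ : ℂ)⁻¹ * (f (τ.toFun ⟨h.tgt, h.tgt_mem⟩) * ψ h.op) -
          f (τ.toFun ⟨h.src, h.src_mem⟩) * ((h.len δ : ℂ)⁻¹ * ψ h.op) := rfl
    have h6 : ψ h.op = 1 := by simp [hψdef]
    have hpos := h.len_pos hδ
    change ‖(dirac X δ ⟨rep τ f ψ, h1⟩ - rep τ f (dirac X δ ⟨ψ, hdom⟩)) h‖ ≤ 1 at h3
    rw [h5, h6, show (h.len δ : ℂ)⁻¹ * (f (τ.toFun ⟨h.tgt, h.tgt_mem⟩) * 1) -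
          f (τ.toFun ⟨h.src, h.src_mem⟩) * ((h.len δ : ℂ)⁻¹ * 1) =
          (h.len δ : ℂ)⁻¹ * (f (τ.toFun ⟨h.tgt, h.tgt_mem⟩) - f (τ.toFun ⟨h.src, h.src_mem⟩)) by
          ring, norm_mul, norm_inv, Complex.norm_real, Real.norm_of_nonneg hpos.le,
          inv_mul_le_iff₀ hpos, mul_one] at h3
    rwa [norm_sub_rev]
  · rintro H ⟨ψ, hψ⟩
    have hψ' : Memℓp (fun h : PrivilegedEdge X => ((h.len δ : ℂ))⁻¹ * ψ h.op) 2 := hψ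
    have hdom : rep τ f ψ ∈ (dirac X δ).domain := by
      change Memℓp (fun h : PrivilegedEdge X => ((h.len δ : ℂ))⁻¹ *
        (f (τ.toFun ⟨h.tgt, h.tgt_mem⟩) * ψ h.op)) 2
      refine Memℓp.mono' (hψ'.const_smul (‖f‖ : ℂ)) fun h => ?_
      simp only [Pi.smul_apply, smul_eq_mul, norm_mul, Complex.norm_real, norm_norm]
      rw [mul_left_comm]
      gcongr
      exact f.norm_coe_le_norm _
    refine ⟨hdom, ?_⟩
    refine lp.norm_le_of_forall_sum_le (by norm_num) (norm_nonneg _) fun s => ?_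
    have h1 : ∀ h : PrivilegedEdge X,
        ‖(dirac X δ ⟨rep τ f ψ, hdom⟩ - rep τ f (dirac X δ ⟨ψ, hψ⟩)) h‖ ≤ ‖ψ h.op‖ := by
      intro h
      have h5 : (dirac X δ ⟨rep τ f ψ, hdom⟩ - rep τ f (dirac X δ ⟨ψ, hψ⟩)) h =
        (h.len δ : ℂ)⁻¹ * (f (τ.toFun ⟨h.tgt, h.tgt_mem⟩) * ψ h.op) -
          f (τ.toFun ⟨h.src, h.src_mem⟩) * ((h.len δ : ℂ)⁻¹ * ψ h.op) := rfl
      have hpos := h.len_pos hδ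
      rw [h5, show (h.len δ : ℂ)⁻¹ * (f (τ.toFun ⟨h.tgt, h.tgt_mem⟩) * ψ h.op) -
          f (τ.toFun ⟨h.src, h.src_mem⟩) * ((h.len δ : ℂ)⁻¹ * ψ h.op) =
          (h.len δ : ℂ)⁻¹ * (f (τ.toFun ⟨h.tgt, h.tgt_mem⟩) - f (τ.toFun ⟨h.src, h.src_mem⟩))
            * ψ h.op by ring, norm_mul]
      refine mul_le_of_le_one_left (norm_nonneg _) ?_
      rw [norm_mul, norm_inv, Complex.norm_real, Real.norm_of_nonneg hpos.le,
          inv_mul_le_iff₀ hpos, mul_one, norm_sub_rev]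
      exact H h
    calc _ ≤ ∑ h ∈ s, ‖ψ h.op‖ ^ (2 : ℝ≥0∞).toReal := by
          gcongr with h _
          exact h1 h
      _ = ∑ h ∈ s.map ⟨_, PrivilegedEdge.op_injective⟩, ‖ψ h‖ ^ (2 : ℝ≥0∞).toReal := by
          simp
      _ ≤ ‖ψ‖ ^ (2 : ℝ≥0∞).toReal := lp.sum_rpow_le_norm_rpow (by norm_num) ψ _

end Commutator

section Choice

variable {A : Type*} [TopologicalSpace A]

theorem exists_append_mem_language {X : Subshift A ℕ} {w : List A} (hw : w ∈ language X) :
    ∃ a, w ++ [a] ∈ language X := by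
  obtain ⟨x, hx, h⟩ := mem_language_iff.mp hw
  refine ⟨x w.length, ?_⟩
  have := factor_mem_language hx 0 (w.length + 1)
  rwa [← factor_append_singleton, zero_add, (h : factor x 0 w.length = w)] at this

open Classical in
/-- The letter following the word `w`: the preferred letter `e w` if this is possible in the
language. -/
def nextLetter (X : Subshift A ℕ) (e : List A → A) (w : List A) : A :=
  if w ++ [e w] ∈ language X then e w
  else if h : ∃ a, w ++ [a] ∈ language X then h.choose else e w

theorem append_nextLetter_mem_language {X : Subshift A ℕ} (e : List A → A) {w : List A}
    (hw : w ∈ language X) : w ++ [nextLetter X e w] ∈ language X := by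
  unfold nextLetter
  split_ifs with h1 h2
  · exact h1
  · exact h2.choose_spec
  · exact absurd (exists_append_mem_language hw) h2

theorem nextLetter_eq {X : Subshift A ℕ} {e : List A → A} {w : List A}
    (h : w ++ [e w] ∈ language X) : nextLetter X e w = e w := if_pos h

/-- The extension of the word `w` by `k` preferred letters. -/
def extendWord (X : Subshift A ℕ) (e : List A → A) (w : List A) : ℕ → List A
  | 0 => w
  | k + 1 => extendWord X e w k ++ [nextLetter X e (extendWord X e w k)]

theorem length_extendWord (X : Subshift A ℕ) (e : List A → A) (w : List A) (k : ℕ) :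
    (extendWord X e w k).length = w.length + k := by
  induction k with
  | zero => rfl
  | succ k ih => simp [extendWord, ih, add_assoc]

theorem extendWord_mem_language {X : Subshift A ℕ} (e : List A → A) {w : List A}
    (hw : w ∈ language X) (k : ℕ) : extendWord X e w k ∈ language X := by
  induction k with
  | zero => exact hw
  | succ k ih => exact append_nextLetter_mem_language e ih

/-- A sequence follows the preferences `e` after its prefix `w`. -/
def Follows (X : Subshift A ℕ) (e : List A → A) (w : List A) (x : ℕ → A) : Prop :=
  IsPrefixOfSeq w x ∧ ∀ n, w.length ≤ n → x n = nextLetter X e (factor x 0 n)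

theorem Follows.unique {X : Subshift A ℕ} {e : List A → A} {w : List A} {x y : ℕ → A}
    (hx : Follows X e w x) (hy : Follows X e w y) : x = y := by
  funext n
  induction n using Nat.strong_induction_on with
  | _ n ih =>
    rcases lt_or_ge n w.length with h | h
    · rw [isPrefixOfSeq_iff.mp hx.1 n h, isPrefixOfSeq_iff.mp hy.1 n h]
    · rw [hx.2 n h, hy.2 n h, show factor x 0 n = factor y 0 n from
        factor_eq_iff.mpr fun i hi => by simpa using ih i hi]

theorem Follows.of_prefix {X : Subshift A ℕ} {e : List A → A} {w v : List A} {x : ℕ → A}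
    (hx : Follows X e w x) (hwv : w.length ≤ v.length) (hv : IsPrefixOfSeq v x) :
    Follows X e v x :=
  ⟨hv, fun n hn => hx.2 n (hwv.trans hn)⟩

theorem exists_follows [DiscreteTopology A] (X : Subshift A ℕ) (e : List A → A) {w : List A}
    (hw : w ∈ language X) : ∃ x ∈ X.carrier, Follows X e w x := by
  have hpre : ∀ k j, extendWord X e w k <+: extendWord X e w (k + j) := by
    intro k j
    induction j with
    | zero => exact List.prefix_rfl
    | succ j ih => exact ih.trans (List.prefix_append _ _)
  let x : ℕ → A := fun n => (extendWord X e w (n + 1))[n]'(by rw [length_extendWord]; omega)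
  have hx : ∀ k, IsPrefixOfSeq (extendWord X e w k) x := by
    intro k
    rw [isPrefixOfSeq_iff]
    intro i hi
    rcases le_total k (i + 1) with h | h
    · obtain ⟨j, hj⟩ := Nat.exists_eq_add_of_le h
      have := (hpre k j).getElem (i := i) hi
      simp only [x, hj]
      exact this.symm
    · obtain ⟨j, hj⟩ := Nat.exists_eq_add_of_le h
      subst hj
      exact (hpre (i + 1) j).getElem (i := i) (by rw [length_extendWord]; omega)
  have hx' : ∀ k, factor x 0 (w.length + k) = extendWord X e w k := by
    intro k
    have := hx k
    rwa [IsPrefixOfSeq, length_extendWord] at this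
  refine ⟨x, mem_carrier_of_factor_mem_language fun l => ?_, hx 0, fun n hn => ?_⟩
  · obtain ⟨y, hy, hyp⟩ := mem_language_iff.mp (extendWord_mem_language e hw l)
    refine mem_language_of_isPrefixOfSeq hy ?_
    rw [← hx'] at hyp
    exact isPrefixOfSeq_factor_mono (by omega) hyp
  · obtain ⟨k, rfl⟩ := Nat.exists_eq_add_of_le hn
    have h1 := hx' (k + 1)
    rw [extendWord, ← hx' k, ← add_assoc, ← factor_append_singleton, zero_add] at h1
    simpa using h1

/-- The choice function determined by a preferred letter after each word. -/
def preferenceChoice [DiscreteTopology A] (X : Subshift A ℕ) (e : List A → A) :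
    ChoiceFunction X where
  toFun v := ⟨(exists_follows X e v.2).choose, (exists_follows X e v.2).choose_spec.1⟩
  isPrefix v := (exists_follows X e v.2).choose_spec.2.1
  coherent w v hwv _ := by
    constructor
    · intro h
      rw [h]
      exact (exists_follows X e v.2).choose_spec.2.1
    · intro h
      refine Subtype.ext ?_
      exact ((exists_follows X e w.2).choose_spec.2.of_prefix hwv.length_le h).unique
        (exists_follows X e v.2).choose_spec.2

theorem follows_preferenceChoice [DiscreteTopology A] (X : Subshift A ℕ) (e : List A → A)
    (v : language X) : Follows X e v.1 ((preferenceChoice X e).toFun v).1 :=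
  (exists_follows X e v.2).choose_spec.2

theorem preferenceChoice_eq [DiscreteTopology A] {X : Subshift A ℕ} {e : List A → A}
    (v : language X) {x : X.carrier} (hv : IsPrefixOfSeq v.1 x.1)
    (h : ∀ n, v.1.length ≤ n → e (factor x.1 0 n) = x.1 n) :
    (preferenceChoice X e).toFun v = x := by
  refine Subtype.ext ((follows_preferenceChoice X e v).unique ⟨hv, fun n hn => ?_⟩)
  rw [nextLetter_eq, h n hn]
  rw [h n hn]
  have := factor_append_singleton x.1 0 n
  rw [zero_add] at this
  rw [this]
  exact factor_mem_language x.2 0 _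

end Choice

section Distances

variable {A : Type*}

/-- A word shared as a prefix by two sequences of which only one has the prefix `v`, a complete
first return to the privileged word `u`, is no longer than `u` if it is privileged. -/
theorem IsPrivileged.length_le_of_separated {b u v : List A} {x y : ℕ → A} (hb : IsPrivileged b)
    (hu : IsPrivileged u) (huv : IsCompleteFirstReturn u v) (hbx : IsPrefixOfSeq b x)
    (hby : IsPrefixOfSeq b y) (hvx : IsPrefixOfSeq v x) (hvy : ¬ IsPrefixOfSeq v y) :
    b.length ≤ u.length := by
  have hlt : b.length < v.length := by
    by_contra! hcon
    exact hvy (hby.of_prefix (hvx.prefix_of_length_le hbx hcon))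
  exact hb.length_le hu huv (hbx.prefix_of_length_le hvx hlt.le) hlt

variable [TopologicalSpace A]

theorem isClopen_cylinder [DiscreteTopology A] (X : Subshift A ℕ) (w : List A) :
    IsClopen {x : X.carrier | IsPrefixOfSeq w x.1} := by
  have : {x : X.carrier | IsPrefixOfSeq w x.1} =
      ⋂ i : Fin w.length, {x : X.carrier | x.1 i = w[i]} := by
    ext x
    simp only [Set.mem_ofPred_eq, isPrefixOfSeq_iff, Set.mem_iInter]
    exact ⟨fun h i => h i i.2, fun h i hi => h ⟨i, hi⟩⟩
  rw [this]
  refine isClopen_iInter_of_finite fun i => ?_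
  have hc : Continuous fun x : X.carrier => x.1 (i : ℕ) :=
    (continuous_apply _).comp continuous_subtype_val
  exact (isClopen_discrete {w[i]}).preimage hc

open Classical in
/-- The indicator function of the cylinder of sequences with prefix `w`. -/
def cylinderIndicator [DiscreteTopology A] (X : Subshift A ℕ) (w : List A) : C(X.carrier, ℂ) :=
  (LocallyConstant.charFn ℂ (isClopen_cylinder X w) : LocallyConstant X.carrier ℂ).toContinuousMap

theorem cylinderIndicator_of_prefix [DiscreteTopology A] {X : Subshift A ℕ} {w : List A}
    {x : X.carrier} (h : IsPrefixOfSeq w x.1) : cylinderIndicator X w x = 1 :=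
  Set.indicator_of_mem (s := {x : X.carrier | IsPrefixOfSeq w x.1}) h _

theorem cylinderIndicator_of_not_prefix [DiscreteTopology A] {X : Subshift A ℕ} {w : List A}
    {x : X.carrier} (h : ¬ IsPrefixOfSeq w x.1) : cylinderIndicator X w x = 0 :=
  Set.indicator_of_notMem (s := {x : X.carrier | IsPrefixOfSeq w x.1}) h _

theorem PrivilegedEdge.base_isPrefixOfSeq_src {X : Subshift A ℕ} (τ : ChoiceFunction X)
    (h : PrivilegedEdge X) : IsPrefixOfSeq h.base (τ.toFun ⟨h.src, h.src_mem⟩).1 :=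
  (τ.isPrefix _).of_prefix h.src_return.1

theorem PrivilegedEdge.base_isPrefixOfSeq_tgt {X : Subshift A ℕ} (τ : ChoiceFunction X)
    (h : PrivilegedEdge X) : IsPrefixOfSeq h.base (τ.toFun ⟨h.tgt, h.tgt_mem⟩).1 :=
  (τ.isPrefix _).of_prefix h.tgt_return.1

/-- Every prefix of every sequence of the subshift recurs. -/
def IsRecurrent (X : Subshift A ℕ) : Prop :=
  ∀ x ∈ X.carrier, ∀ l, ∃ r, 0 < r ∧ factor x r l = factor x 0 l

/-- Two distinct sequences of a recurrent subshift branch at a privileged word. -/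
theorem exists_privileged_branching {X : Subshift A ℕ} (hX : IsRecurrent X) {ξ η : ℕ → A}
    (hξ : ξ ∈ X.carrier) (hη : η ∈ X.carrier) (hne : ξ ≠ η) :
    ∃ u v v' : List A, IsPrivileged u ∧ IsCompleteFirstReturn u v ∧ IsCompleteFirstReturn u v' ∧
      v ≠ v' ∧ IsPrefixOfSeq v ξ ∧ IsPrefixOfSeq v' η := by
  classical
  obtain ⟨N, hN⟩ := Function.ne_iff.mp hne
  let P : ℕ → Prop := fun l => IsPrivileged (factor ξ 0 l) ∧ factor ξ 0 l = factor η 0 l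
  have hPN : ∀ l, P l → l ≤ N := by
    rintro l ⟨-, h⟩
    by_contra! hcon
    exact hN (by simpa using factor_eq_iff.mp h N hcon)
  have hP0 : P 0 := ⟨by simpa [factor] using IsPrivileged.nil, by simp [factor]⟩
  have hP := Nat.findGreatest_spec (P := P) (Nat.zero_le N) hP0
  set l := Nat.findGreatest P N
  obtain ⟨r, h0, -, -, hr⟩ := exists_isCompleteFirstReturn_factor (hX ξ hξ l)
  obtain ⟨r', h0', -, -, hr'⟩ := exists_isCompleteFirstReturn_factor (hX η hη l)
  rw [← hP.2] at hr'
  refine ⟨_, _, _, hP.1, hr, hr', fun he => ?_, isPrefixOfSeq_factor_self _ _,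
    isPrefixOfSeq_factor_self _ _⟩
  have hlen := congrArg List.length he
  simp only [length_factor] at hlen
  rw [← hlen] at he
  have hP' : P (r + l) := ⟨IsPrivileged.step _ _ hP.1 hr, he⟩
  have := Nat.le_findGreatest (hPN _ hP') hP'
  change r + l ≤ l at this
  omega

theorem exists_privileged_chain {X : Subshift A ℕ} (hX : IsRecurrent X) {x : ℕ → A}
    (hx : x ∈ X.carrier) {l₀ : ℕ} (h : IsPrivileged (factor x 0 l₀)) :
    ∃ l : ℕ → ℕ, l 0 = l₀ ∧ ∀ n, IsPrivileged (factor x 0 (l n)) ∧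
      IsCompleteFirstReturn (factor x 0 (l n)) (factor x 0 (l (n + 1))) ∧
      ∃ r, 0 < r ∧ l (n + 1) = r + l n ∧ factor x r (l n) = factor x 0 (l n) := by
  choose r h0 h1 _ h3 using fun l => exists_isCompleteFirstReturn_factor (hX x hx l)
  let l : ℕ → ℕ := fun n => (fun m => r m + m)^[n] l₀
  have hl : ∀ n, l (n + 1) = r (l n) + l n := fun n => by
    simp only [l, Function.iterate_succ_apply']
  have hp : ∀ n, IsPrivileged (factor x 0 (l n)) := by
    intro n
    induction n with
    | zero => exact h
    | succ n ih =>
      rw [hl]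
      exact IsPrivileged.step _ _ ih (h3 _)
  refine ⟨l, rfl, fun n => ⟨hp n, ?_, r (l n), h0 _, hl n, h1 _⟩⟩
  rw [hl]
  exact h3 _

variable [Finite A]

theorem enorm_sub_le_connesDist {X : Subshift A ℕ} {δ : ℝ → ℝ} {τ : ChoiceFunction X}
    {f : C(X.carrier, ℂ)} (hf : CommutatorNormLEOne δ τ f) (ξ η : X.carrier) :
    ‖f ξ - f η‖ₑ ≤ connesDist δ τ ξ η :=
  le_iSup₂ (f := fun (f : C(X.carrier, ℂ)) (_ : CommutatorNormLEOne δ τ f) => ‖f ξ - f η‖ₑ) f hf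

theorem IsLengthFunction.anti {δ : ℝ → ℝ} (hδ : IsLengthFunction δ) {a b : ℝ} (ha : 0 ≤ a)
    (hab : a ≤ b) : δ b ≤ δ a :=
  hδ.strictAnti.antitoneOn (Set.mem_Ici.mpr ha) (Set.mem_Ici.mpr (ha.trans hab)) hab

theorem ofReal_length_le_connesDist [DiscreteTopology A] {X : Subshift A ℕ} {δ : ℝ → ℝ}
    (hδ : IsLengthFunction δ) (τ : ChoiceFunction X) {ξ η : X.carrier} {u v : List A}
    (hu : IsPrivileged u) (huv : IsCompleteFirstReturn u v) (hξ : IsPrefixOfSeq v ξ.1)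
    (hη : ¬ IsPrefixOfSeq v η.1) : ENNReal.ofReal (δ u.length) ≤ connesDist δ τ ξ η := by
  have hpos : 0 < δ u.length := hδ.pos _ (Nat.cast_nonneg _)
  let f : C(X.carrier, ℂ) := (δ u.length : ℂ) • cylinderIndicator X v
  have hf : CommutatorNormLEOne δ τ f := by
    rw [commutatorNormLEOne_iff hδ]
    intro h
    have e1 := h.base_isPrefixOfSeq_src τ
    have e2 := h.base_isPrefixOfSeq_tgt τ
    have key : ∀ n : ℕ, n ≤ u.length → δ u.length ≤ δ n := fun n hn =>
      hδ.anti (Nat.cast_nonneg _) (Nat.cast_le.mpr hn)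
    by_cases h1 : IsPrefixOfSeq v (τ.toFun ⟨h.src, h.src_mem⟩).1 <;>
      by_cases h2 : IsPrefixOfSeq v (τ.toFun ⟨h.tgt, h.tgt_mem⟩).1
    · simpa [f, cylinderIndicator_of_prefix h1, cylinderIndicator_of_prefix h2]
        using (h.len_pos hδ).le
    · simpa [f, cylinderIndicator_of_prefix h1, cylinderIndicator_of_not_prefix h2,
        abs_of_pos hpos, PrivilegedEdge.len] using
        key h.base.length (h.base_privileged.length_le_of_separated hu huv e1 e2 h1 h2)
    · simpa [f, cylinderIndicator_of_not_prefix h1, cylinderIndicator_of_prefix h2,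
        abs_of_pos hpos, PrivilegedEdge.len] using
        key h.base.length (h.base_privileged.length_le_of_separated hu huv e2 e1 h2 h1)
    · simpa [f, cylinderIndicator_of_not_prefix h1, cylinderIndicator_of_not_prefix h2]
        using (h.len_pos hδ).le
  refine le_trans (le_of_eq ?_) (enorm_sub_le_connesDist hf ξ η)
  simp only [f, ContinuousMap.smul_apply, cylinderIndicator_of_prefix hξ,
    cylinderIndicator_of_not_prefix hη, smul_eq_mul, mul_one, mul_zero, sub_zero]
  rw [← ofReal_norm, Complex.norm_real, Real.norm_of_nonneg hpos.le]

theorem norm_sub_le_of_edge {X : Subshift A ℕ} {δ : ℝ → ℝ} (hδ : IsLengthFunction δ)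
    {τ : ChoiceFunction X} {f : C(X.carrier, ℂ)} (hf : CommutatorNormLEOne δ τ f) {u : List A}
    (v v' : language X) (hu : IsPrivileged u) (hv : IsCompleteFirstReturn u v.1)
    (hv' : IsCompleteFirstReturn u v'.1) :
    ‖f (τ.toFun v) - f (τ.toFun v')‖ ≤ δ u.length := by
  by_cases h : v = v'
  · subst h
    simpa using (hδ.pos _ (Nat.cast_nonneg _)).le
  · exact (commutatorNormLEOne_iff hδ).mp hf
      ⟨u, v.1, v'.1, hu, v.2, v'.2, hv, hv', fun e => h (Subtype.ext e)⟩

theorem connesDist_le {X : Subshift A ℕ} {δ : ℝ → ℝ} {τ : ChoiceFunction X} {ξ η : X.carrier}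
    {B : ℝ} (h : ∀ f : C(X.carrier, ℂ), CommutatorNormLEOne δ τ f → ‖f ξ - f η‖ ≤ B) :
    connesDist δ τ ξ η ≤ ENNReal.ofReal B := by
  refine iSup₂_le fun f hf => ?_
  rw [← ofReal_norm]
  exact ENNReal.ofReal_le_ofReal (h f hf)

theorem dInf_le_ofReal_length [DiscreteTopology A] {X : Subshift A ℕ} {δ : ℝ → ℝ}
    (hδ : IsLengthFunction δ) {ξ η : X.carrier} {u v v' : List A}
    (hu : IsPrivileged u) (hv : IsCompleteFirstReturn u v) (hv' : IsCompleteFirstReturn u v')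
    (hvv' : v ≠ v') (hξ : IsPrefixOfSeq v ξ.1) (hη : IsPrefixOfSeq v' η.1) :
    dInf X δ ξ η ≤ ENNReal.ofReal (δ u.length) := by
  classical
  let e : List A → A := fun w => if IsPrefixOfSeq w ξ.1 then ξ.1 w.length else η.1 w.length
  refine (iInf_le _ (preferenceChoice X e)).trans (connesDist_le fun f hf => ?_)
  have hvL := mem_language_of_isPrefixOfSeq ξ.2 hξ
  have hvL' := mem_language_of_isPrefixOfSeq η.2 hη
  have h1 : (preferenceChoice X e).toFun ⟨v, hvL⟩ = ξ := by
    refine preferenceChoice_eq _ hξ fun n _ => ?_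
    simp [e, isPrefixOfSeq_factor_self]
  have h2 : (preferenceChoice X e).toFun ⟨v', hvL'⟩ = η := by
    refine preferenceChoice_eq _ hη fun n hn => ?_
    have : ¬ IsPrefixOfSeq (factor η.1 0 n) ξ.1 := by
      intro hcon
      have hp : IsPrefixOfSeq v' ξ.1 := hcon.of_prefix
        (hη.prefix_of_length_le (isPrefixOfSeq_factor_self _ _) (by simpa using hn))
      rcases le_total v.length v'.length with h | h
      · exact hvv' (hv.eq_of_prefix hv' (hξ.prefix_of_length_le hp h))
      · exact hvv' (hv'.eq_of_prefix hv (hp.prefix_of_length_le hξ h)).symm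
    simp [e, this]
  have := norm_sub_le_of_edge hδ hf ⟨v, hvL⟩ ⟨v', hvL'⟩ hu hv hv'
  rwa [h1, h2] at this

theorem norm_sub_le_of_return {X : Subshift A ℕ} (hX : IsRecurrent X) {δ : ℝ → ℝ}
    (hδ : IsLengthFunction δ)
    {τ : ChoiceFunction X} {f : C(X.carrier, ℂ)} (hf : CommutatorNormLEOne δ τ f)
    (u v : language X) (hu : IsPrivileged u.1) (hv : IsCompleteFirstReturn u.1 v.1) :
    ‖f (τ.toFun u) - f (τ.toFun v)‖ ≤ δ u.1.length := by
  obtain ⟨r, h0, -, -, hr⟩ := exists_isCompleteFirstReturn_factor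
    (hX _ (τ.toFun u).2 u.1.length)
  rw [(τ.isPrefix u : factor (τ.toFun u).1 0 u.1.length = u.1)] at hr
  have hw := factor_mem_language (τ.toFun u).2 0 (r + u.1.length)
  have hne : u ≠ ⟨_, hw⟩ := by
    intro he
    have := congrArg (fun w : language X => w.1.length) he
    simp only [length_factor] at this
    omega
  have := (τ.coherent u ⟨_, hw⟩ hr.1 hne).mpr (isPrefixOfSeq_factor_self _ _)
  rw [this]
  exact norm_sub_le_of_edge hδ hf ⟨_, hw⟩ v hu hr hv

/-- The path from `τ(v)` to `ξ` along the privileged prefixes of `ξ`. -/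
theorem norm_sub_le_of_chain [DiscreteTopology A] {X : Subshift A ℕ} (hX : IsRecurrent X)
    {δ : ℝ → ℝ} (hδ : IsLengthFunction δ) {τ : ChoiceFunction X} {f : C(X.carrier, ℂ)}
    (hf : CommutatorNormLEOne δ τ f) (ξ : X.carrier) {l : ℕ → ℕ} (hl : StrictMono l)
    (hp : ∀ n, IsPrivileged (factor ξ.1 0 (l n)))
    (hc : ∀ n, IsCompleteFirstReturn (factor ξ.1 0 (l n)) (factor ξ.1 0 (l (n + 1))))
    {B : ℝ} (hB : ∀ n, ∑ i ∈ Finset.range n, δ (l i) ≤ B) :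
    ‖f (τ.toFun ⟨_, factor_mem_language ξ.2 0 (l 0)⟩) - f ξ‖ ≤ B := by
  let y : ℕ → X.carrier := fun n => τ.toFun ⟨_, factor_mem_language ξ.2 0 (l n)⟩
  have hy : Tendsto y atTop (𝓝 ξ) := by
    rw [tendsto_subtype_rng, tendsto_pi_nhds]
    intro i
    refine tendsto_const_nhds.congr' ?_
    filter_upwards [eventually_gt_atTop i] with n hn
    have h1 := τ.isPrefix ⟨_, factor_mem_language ξ.2 0 (l n)⟩
    have := isPrefixOfSeq_factor.mp h1 i (hn.trans_le hl.le_apply)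
    simpa using this.symm
  have hbound : ∀ n, ‖f (y 0) - f (y n)‖ ≤ B := by
    intro n
    refine le_trans ?_ (hB n)
    induction n with
    | zero => simp
    | succ n ih =>
      rw [Finset.sum_range_succ]
      refine (norm_sub_le_norm_sub_add_norm_sub _ (f (y n)) _).trans (add_le_add ih ?_)
      have := norm_sub_le_of_return hX hδ hf ⟨_, factor_mem_language ξ.2 0 (l n)⟩
        ⟨_, factor_mem_language ξ.2 0 (l (n + 1))⟩ (hp n) (hc n)
      simpa using this
  have hlim : Tendsto (fun n => ‖f (y 0) - f (y n)‖) atTop (𝓝 ‖f (y 0) - f ξ‖) :=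
    (tendsto_const_nhds.sub ((f.continuous.tendsto ξ).comp hy)).norm
  exact le_of_tendsto' hlim hbound

end Distances

section Summation

/-- Lengths growing geometrically have summable edge lengths, dominated by the first one. -/
theorem exists_sum_le_mul {δ : ℝ → ℝ} (hδ : IsLengthFunction δ)
    (hδ' : ∃ c > 0, ∃ R : ℝ, ∀ a ≥ R, ∀ b ≥ R, δ (a * b) ≤ c * δ a * δ b) {K : ℝ} (hK : 0 < K) :
    ∃ S : ℝ, 0 ≤ S ∧ ∀ l : ℕ → ℕ, 0 < l 0 → (∀ n, (l n : ℝ) ≤ K * (l (n + 1) - l n)) →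
      ∀ n, ∑ i ∈ Finset.range n, δ (l i) ≤ S * δ (l 0) := by
  obtain ⟨c, hc, R, hR⟩ := hδ'
  have hpos : ∀ n : ℕ, 0 < δ n := fun n => hδ.pos _ (Nat.cast_nonneg _)
  obtain ⟨a, haR, ha1, ha⟩ : ∃ a, R ≤ a ∧ 1 ≤ a ∧ δ a < 1 / (2 * c) :=
    ((eventually_ge_atTop R).and ((eventually_ge_atTop 1).and
      (hδ.tendsto.eventually_lt_const (by positivity)))).exists
  have hhalf : ∀ b, R ≤ b → 0 ≤ b → δ (a * b) ≤ δ b / 2 := by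
    intro b hb hb0
    refine (hR a haR b hb).trans ?_
    have h1 : c * δ a ≤ 1 / 2 := by
      rw [lt_div_iff₀ (by positivity)] at ha
      linarith
    have := mul_le_mul_of_nonneg_right h1 (hδ.pos b hb0).le
    linarith
  have hκ : 1 < 1 + 1 / K := by
    have : 0 < 1 / K := by positivity
    linarith
  obtain ⟨p, hp⟩ := pow_unbounded_of_one_lt a hκ
  obtain ⟨p', hp'⟩ := pow_unbounded_of_one_lt R hκ
  have growth : ∀ l : ℕ → ℕ, (∀ n, (l n : ℝ) ≤ K * (l (n + 1) - l n)) → ∀ m n,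
      (1 + 1 / K) ^ n * (l m : ℝ) ≤ l (m + n) := by
    intro l hl m n
    induction n with
    | zero => simp
    | succ n ih =>
      have h1 : (1 + 1 / K) * (l (m + n) : ℝ) ≤ l (m + n + 1) := by
        have := hl (m + n)
        rw [← div_le_iff₀' hK] at this
        have e : (1 + 1 / K) * (l (m + n) : ℝ) = l (m + n) + l (m + n) / K := by ring
        rw [e]
        linarith
      calc (1 + 1 / K) ^ (n + 1) * (l m : ℝ) = (1 + 1 / K) * ((1 + 1 / K) ^ n * l m) := by ring
        _ ≤ (1 + 1 / K) * l (m + n) := by gcongr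
        _ ≤ _ := h1
  have mono : ∀ l : ℕ → ℕ, (∀ n, (l n : ℝ) ≤ K * (l (n + 1) - l n)) → ∀ m n, l m ≤ l (m + n) := by
    intro l hl m n
    have := growth l hl m n
    have h2 : (1 : ℝ) ≤ (1 + 1 / K) ^ n := one_le_pow₀ hκ.le
    have h3 : (l m : ℝ) ≤ l (m + n) := by nlinarith [(Nat.cast_nonneg (l m) : (0 : ℝ) ≤ _)]
    exact_mod_cast h3
  have split : ∀ l : ℕ → ℕ, (∀ n, (l n : ℝ) ≤ K * (l (n + 1) - l n)) → ∀ s n,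
      ∑ i ∈ Finset.range n, δ (l i) ≤ s * δ (l 0) + ∑ i ∈ Finset.range n, δ (l (s + i)) := by
    intro l hl s n
    calc ∑ i ∈ Finset.range n, δ (l i) ≤ ∑ i ∈ Finset.range (s + n), δ (l i) :=
          Finset.sum_le_sum_of_subset_of_nonneg (Finset.range_mono (by omega))
            fun i _ _ => (hpos _).le
      _ = ∑ i ∈ Finset.range s, δ (l i) + ∑ i ∈ Finset.range n, δ (l (s + i)) :=
          Finset.sum_range_add _ _ _
      _ ≤ _ := by
          gcongr
          refine (Finset.sum_le_card_nsmul _ _ (δ (l 0)) fun i _ => ?_).trans (by simp)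
          have := mono l hl 0 i
          rw [zero_add] at this
          exact hδ.anti (Nat.cast_nonneg _) (Nat.cast_le.mpr this)
  have large : ∀ l : ℕ → ℕ, R ≤ l 0 → (∀ n, (l n : ℝ) ≤ K * (l (n + 1) - l n)) →
      ∀ n, ∑ i ∈ Finset.range n, δ (l i) ≤ 2 * p * δ (l 0) := by
    intro l hl0 hl n
    have h1 := split l hl p n
    have h2 : ∑ i ∈ Finset.range n, δ (l (p + i)) ≤ (∑ i ∈ Finset.range n, δ (l i)) / 2 := by
      rw [Finset.sum_div]
      refine Finset.sum_le_sum fun i _ => ?_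
      have h3 : R ≤ l i := by
        have := mono l hl 0 i
        rw [zero_add] at this
        exact hl0.trans (Nat.cast_le.mpr this)
      refine le_trans ?_ (hhalf (l i) h3 (Nat.cast_nonneg _))
      refine hδ.anti (by positivity) ?_
      rw [add_comm p i]
      refine le_trans ?_ (growth l hl i p)
      gcongr
    linarith
  refine ⟨p' + 2 * p, by positivity, fun l h0 hl n => ?_⟩
  have h1 := split l hl p' n
  have h2 := large (fun i => l (p' + i)) ?_ (fun n => hl (p' + n)) n
  · have h3 : δ (l (p' + 0)) ≤ δ (l 0) := by
      have := mono l hl 0 p'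
      rw [zero_add] at this
      exact hδ.anti (Nat.cast_nonneg _) (Nat.cast_le.mpr this)
    have h4 : 2 * p * δ (l (p' + 0)) ≤ 2 * p * δ (l 0) := by gcongr
    linarith
  · have := growth l hl 0 p'
    rw [zero_add] at this
    refine le_trans ?_ this
    have h5 : (1 : ℝ) ≤ l 0 := by exact_mod_cast h0
    have h6 : 0 ≤ (1 + 1 / K) ^ p' := by positivity
    nlinarith

end Summation

section LinearRepetitivity

variable {A : Type*} [TopologicalSpace A]

theorem IsLinearlyRepetitive.isRecurrent {X : Subshift A ℕ} (hX : IsLinearlyRepetitive X) :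
    IsRecurrent X := by
  intro x hx l
  obtain ⟨C, hC⟩ := hX
  obtain ⟨N, hN⟩ := exists_nat_ge (C * l)
  obtain ⟨i, -, hi⟩ := infix_factor (hC _ (factor_mem_language hx 0 l) _
    (factor_mem_language hx 1 N) (by simpa using hN))
  refine ⟨1 + i, by omega, ?_⟩
  simpa using hi

/-- In a linearly repetitive subshift that is not periodic, a word of length `l` recurs only after
a time proportional to `l`. -/
theorem IsLinearlyRepetitive.exists_return_bound {X : Subshift A ℕ} (hX : IsLinearlyRepetitive X)
    {y : ℕ → A} (hy : y ∈ X.carrier) (hper : ∀ r, 0 < r → ∃ i, y (i + r) ≠ y i) :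
    ∃ K : ℝ, 0 < K ∧ ∀ x ∈ X.carrier, ∀ r l, 0 < r → factor x r l = factor x 0 l →
      (l : ℝ) ≤ K * r := by
  obtain ⟨C, hC⟩ := hX
  refine ⟨2 * max C 1, by positivity, fun x hx r l hr h => ?_⟩
  by_contra! hcon
  obtain ⟨i, hi⟩ := hper r hr
  have hr1 : (1 : ℝ) ≤ r := by exact_mod_cast hr
  have hlong : C * (r + 1) ≤ r + l := by
    have h1 : C ≤ max C 1 := le_max_left _ _
    have h2 : 1 ≤ max C 1 := le_max_right _ _
    nlinarith
  obtain ⟨j, hj, hji⟩ := infix_factor (hC _ (factor_mem_language hy i (r + 1)) _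
    (factor_mem_language hx 0 (r + l)) (by simpa using hlong))
  simp only [length_factor, zero_add] at hj hji
  rw [factor_eq_iff] at hji h
  have e1 := hji 0 (by omega)
  have e2 := hji r (by omega)
  have e3 := h j (by omega)
  simp only [add_zero, zero_add] at e1 e2 e3
  rw [add_comm r j, e2, e1] at e3
  exact hi e3

theorem IsLinearlyRepetitive.lipschitzEquivalent [Finite A] [DiscreteTopology A]
    {X : Subshift A ℕ} (hX : IsLinearlyRepetitive X)
    {y : ℕ → A} (hy : y ∈ X.carrier) (hper : ∀ r, 0 < r → ∃ i, y (i + r) ≠ y i)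
    {δ : ℝ → ℝ} (hδ : IsLengthFunction δ) (hδ' : SatisfiesMultiplicativeInequalities δ) :
    LipschitzEquivalent (dInf X δ) (dSup X δ) := by
  have hrec := hX.isRecurrent
  obtain ⟨K, hK, hret⟩ := hX.exists_return_bound hy hper
  obtain ⟨S, hS, hsum⟩ := exists_sum_le_mul hδ hδ'.1 hK
  have tail : ∀ (τ : ChoiceFunction X) (f : C(X.carrier, ℂ)), CommutatorNormLEOne δ τ f →
      ∀ (ξ : X.carrier) (u : List A) (v : language X), IsPrivileged u →
      IsCompleteFirstReturn u v.1 → IsPrefixOfSeq v.1 ξ.1 →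
      ‖f (τ.toFun v) - f ξ‖ ≤ S * δ u.length := by
    intro τ f hf ξ u v hu huv hv
    have hv' : factor ξ.1 0 v.1.length = v.1 := hv
    obtain ⟨l, hl0, hl⟩ := exists_privileged_chain hrec ξ.2 (l₀ := v.1.length)
      (by rw [hv']; exact IsPrivileged.step _ _ hu huv)
    have hlv : 0 < l 0 := by rw [hl0]; exact (Nat.zero_le _).trans_lt huv.length_lt
    have hmono : StrictMono l := strictMono_nat_of_lt_succ fun n => by
      obtain ⟨-, -, r, h0, h1, -⟩ := hl n
      omega
    have hlin : ∀ n, (l n : ℝ) ≤ K * (l (n + 1) - l n) := by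
      intro n
      obtain ⟨-, -, r, h0, h1, h2⟩ := hl n
      have := hret ξ.1 ξ.2 r (l n) h0 h2
      rw [h1]
      push_cast
      simpa using this
    have := norm_sub_le_of_chain hrec hδ hf ξ hmono (fun n => (hl n).1) (fun n => (hl n).2.1)
      (hsum l hlv hlin)
    have e : (⟨_, factor_mem_language ξ.2 0 (l 0)⟩ : language X) = v := by
      refine Subtype.ext ?_
      change factor ξ.1 0 (l 0) = v.1
      rw [hl0, hv']
    rw [e] at this
    refine this.trans ?_
    gcongr
    refine hδ.anti (Nat.cast_nonneg _) ?_
    rw [hl0]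
    exact Nat.cast_le.mpr huv.length_lt.le
  have one : (1 : ℝ≥0∞) ≤ ((1 + 2 * S).toNNReal : ℝ≥0∞) := by
    rw [← ENNReal.coe_one, ENNReal.coe_le_coe, Real.one_le_toNNReal]
    linarith
  have hne : Nonempty A := ⟨y 0⟩
  let τ₀ : ChoiceFunction X := preferenceChoice X fun _ => hne.some
  refine ⟨(1 + 2 * S).toNNReal, by rw [Real.toNNReal_pos]; linarith, fun ξ η => ⟨?_, ?_⟩⟩
  · calc _ ≤ 1 * dInf X δ ξ η := by gcongr; exact ENNReal.inv_le_one.mpr one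
      _ = dInf X δ ξ η := one_mul _
      _ ≤ connesDist δ τ₀ ξ η := iInf_le _ τ₀
      _ ≤ dSup X δ ξ η := le_iSup (fun τ => connesDist δ τ ξ η) τ₀
  · by_cases hξη : ξ = η
    · subst hξη
      simp [dSup, connesDist]
    obtain ⟨u, v, v', hu, hv, hv', hvv', hξ, hη⟩ :=
      exists_privileged_branching hrec ξ.2 η.2 fun h => hξη (Subtype.ext h)
    have hvη : ¬ IsPrefixOfSeq v η.1 := by
      intro hcon
      rcases le_total v.length v'.length with h | h
      · exact hvv' (hv.eq_of_prefix hv' (hcon.prefix_of_length_le hη h))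
      · exact hvv' (hv'.eq_of_prefix hv (hη.prefix_of_length_le hcon h)).symm
    have lower : ENNReal.ofReal (δ u.length) ≤ dInf X δ ξ η :=
      le_iInf fun τ => ofReal_length_le_connesDist hδ τ hu hv hξ hvη
    have upper : dSup X δ ξ η ≤ ENNReal.ofReal ((1 + 2 * S) * δ u.length) := by
      refine iSup_le fun τ => connesDist_le fun f hf => ?_
      have hvL := mem_language_of_isPrefixOfSeq ξ.2 hξ
      have hvL' := mem_language_of_isPrefixOfSeq η.2 hη
      have h1 := tail τ f hf ξ u ⟨v, hvL⟩ hu hv hξ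
      have h2 := tail τ f hf η u ⟨v', hvL'⟩ hu hv' hη
      have h3 := norm_sub_le_of_edge hδ hf ⟨v, hvL⟩ ⟨v', hvL'⟩ hu hv hv'
      rw [norm_sub_rev] at h1
      have h4 := norm_sub_le_norm_sub_add_norm_sub (f ξ) (f (τ.toFun ⟨v, hvL⟩)) (f η)
      have h5 := norm_sub_le_norm_sub_add_norm_sub (f (τ.toFun ⟨v, hvL⟩))
        (f (τ.toFun ⟨v', hvL'⟩)) (f η)
      linarith
    refine upper.trans ?_
    rw [ENNReal.ofReal_mul (by linarith)]
    exact mul_le_mul_right lower _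

end LinearRepetitivity

section SturmianWords

theorem mechanicalWord_mem (θ ρ : ℝ) : mechanicalWord θ ρ ∈ (sturmianSubshift θ).carrier :=
  subset_closure ⟨ρ, rfl⟩

theorem floor_succ_sub_floor (θ ρ : ℝ) (n : ℕ) :
    ⌊((n : ℝ) + 1) * θ + ρ⌋ - ⌊(n : ℝ) * θ + ρ⌋ =
      ⌊θ⌋ + if mechanicalWord θ ρ n = true then 1 else 0 := by
  have h1 : ⌊(n : ℝ) * θ + ρ⌋ + ⌊θ⌋ ≤ ⌊((n : ℝ) + 1) * θ + ρ⌋ := by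
    rw [Int.le_floor]
    push_cast
    linarith [Int.floor_le ((n : ℝ) * θ + ρ), Int.floor_le θ]
  have h2 : ⌊((n : ℝ) + 1) * θ + ρ⌋ < ⌊(n : ℝ) * θ + ρ⌋ + ⌊θ⌋ + 2 := by
    rw [Int.floor_lt]
    push_cast
    linarith [Int.lt_floor_add_one ((n : ℝ) * θ + ρ), Int.lt_floor_add_one θ]
  by_cases h : ⌊((n : ℝ) + 1) * θ + ρ⌋ - ⌊(n : ℝ) * θ + ρ⌋ = ⌊θ⌋ + 1
  · simp [mechanicalWord, h]
  · simp [mechanicalWord, h]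
    omega

theorem mechanicalWord_add (θ ρ : ℝ) (m n : ℕ) :
    mechanicalWord θ ρ (m + n) = mechanicalWord θ (m * θ + ρ) n := by
  simp only [mechanicalWord, Nat.cast_add]
  rw [show ((m : ℝ) + n + 1) * θ + ρ = ((n : ℝ) + 1) * θ + (m * θ + ρ) by ring,
      show ((m : ℝ) + n) * θ + ρ = (n : ℝ) * θ + (m * θ + ρ) by ring]

theorem factor_mechanicalWord (θ ρ : ℝ) (m l : ℕ) :
    factor (mechanicalWord θ ρ) m l = factor (mechanicalWord θ (m * θ + ρ)) 0 l := by
  rw [factor_eq_iff]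
  intro i _
  rw [mechanicalWord_add, zero_add]

/-- Intercepts whose orbits have the same integer parts, up to a constant, give the same word. -/
theorem mechanicalWord_eq_of_floor {θ ρ ρ' : ℝ} {p : ℤ} {n : ℕ}
    (h0 : ⌊(n : ℝ) * θ + ρ'⌋ = ⌊(n : ℝ) * θ + ρ⌋ + p)
    (h1 : ⌊((n : ℝ) + 1) * θ + ρ'⌋ = ⌊((n : ℝ) + 1) * θ + ρ⌋ + p) :
    mechanicalWord θ ρ' n = mechanicalWord θ ρ n := by
  simp only [mechanicalWord, h0, h1, add_sub_add_right_eq_sub]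

theorem factor_mechanicalWord_eq_of_floor {θ ρ ρ' : ℝ} {p : ℤ} {l : ℕ}
    (h : ∀ k : ℕ, k ≤ l → ⌊(k : ℝ) * θ + ρ'⌋ = ⌊(k : ℝ) * θ + ρ⌋ + p) :
    factor (mechanicalWord θ ρ') 0 l = factor (mechanicalWord θ ρ) 0 l := by
  rw [factor_eq_iff]
  intro i hi
  rw [zero_add]
  refine mechanicalWord_eq_of_floor (h i hi.le) ?_
  have := h (i + 1) hi
  push_cast at this
  exact this

theorem mem_language_sturmianSubshift_iff {θ : ℝ} {w : List Bool} :
    w ∈ language (sturmianSubshift θ) ↔ ∃ ρ, IsPrefixOfSeq w (mechanicalWord θ ρ) := by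
  rw [mem_language_iff]
  constructor
  · rintro ⟨x, hx, h⟩
    have hx' : x ∈ closure (Set.range (mechanicalWord θ)) := hx
    rw [mem_closure_iff] at hx'
    obtain ⟨_, hy, ρ, rfl⟩ := hx' (Set.pi (Finset.range w.length : Set ℕ) fun i => {x i})
      (isOpen_set_pi (Finset.finite_toSet _) fun _ _ => isOpen_discrete _) (by simp [Set.mem_pi])
    refine ⟨ρ, ?_⟩
    rw [isPrefixOfSeq_iff] at h ⊢
    intro i hi
    rw [← h i hi]
    exact hy i (by simpa using hi)
  · rintro ⟨ρ, h⟩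
    exact ⟨_, mechanicalWord_mem θ ρ, h⟩

theorem mechanicalWord_not_periodic {θ : ℝ} (hθ : Irrational θ) (ρ : ℝ) (r : ℕ) (hr : 0 < r) :
    ∃ i, mechanicalWord θ ρ (i + r) ≠ mechanicalWord θ ρ i := by
  by_contra! hper
  let F : ℕ → ℤ := fun n => ⌊(n : ℝ) * θ + ρ⌋
  have hF : ∀ n, F (n + 1) - F n = ⌊θ⌋ + if mechanicalWord θ ρ n = true then 1 else 0 := by
    intro n
    rw [← floor_succ_sub_floor]
    simp [F]
  have hk : ∀ n, F (n + r) - F n = F r - F 0 := by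
    intro n
    induction n with
    | zero => simp
    | succ n ih =>
      have h1 := hF n
      have h2 := hF (n + r)
      rw [hper n] at h2
      rw [show n + 1 + r = n + r + 1 by ring]
      omega
  have hj : ∀ j : ℕ, F (j * r) = F 0 + j * (F r - F 0) := by
    intro j
    induction j with
    | zero => simp
    | succ j ih =>
      have := hk (j * r)
      rw [show (j + 1) * r = j * r + r by ring]
      push_cast
      linarith
  have hne : (r : ℝ) * θ - ((F r - F 0 : ℤ) : ℝ) ≠ 0 := by
    intro h
    have h1 := (hθ.natCast_mul hr.ne').ne_int (F r - F 0)
    exact h1 (by linarith)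
  obtain ⟨j, hj'⟩ := exists_nat_gt (1 / |(r : ℝ) * θ - ((F r - F 0 : ℤ) : ℝ)|)
  rw [div_lt_iff₀ (abs_pos.mpr hne)] at hj'
  have e1 : (j : ℝ) * ((r : ℝ) * θ - ((F r - F 0 : ℤ) : ℝ)) =
      (((j * r : ℕ) : ℝ) * θ + ρ - F (j * r)) - (((0 : ℕ) : ℝ) * θ + ρ - F 0) := by
    rw [hj]
    push_cast
    ring
  have e2 : |(j : ℝ) * ((r : ℝ) * θ - ((F r - F 0 : ℤ) : ℝ))| < 1 := by
    rw [e1, abs_lt]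
    have a1 := Int.floor_le (((j * r : ℕ) : ℝ) * θ + ρ)
    have a2 := Int.lt_floor_add_one (((j * r : ℕ) : ℝ) * θ + ρ)
    have a3 := Int.floor_le (((0 : ℕ) : ℝ) * θ + ρ)
    have a4 := Int.lt_floor_add_one (((0 : ℕ) : ℝ) * θ + ρ)
    simp only [F]
    constructor <;> linarith
  rw [abs_mul, Nat.abs_cast] at e2
  linarith

/-- Multiples of `θ` approach integers from above. -/
theorem exists_nat_mul_sub_int_mem_Ico (θ : ℝ) {ε : ℝ} (hε : 0 < ε) :
    ∃ r : ℕ, 0 < r ∧ ∃ p : ℤ, 0 ≤ (r : ℝ) * θ - p ∧ (r : ℝ) * θ - p < ε := by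
  obtain ⟨n, hn⟩ := exists_nat_gt (1 / ε)
  have hn0 : 0 < n := by
    have : (0 : ℝ) < n := lt_trans (by positivity) hn
    exact_mod_cast this
  obtain ⟨k, hk, -, hkn⟩ := Real.exists_nat_abs_mul_sub_round_le θ hn0
  have hsmall : |(k : ℝ) * θ - round ((k : ℝ) * θ)| < ε := by
    refine hkn.trans_lt ?_
    rw [div_lt_iff₀ hε] at hn
    rw [div_lt_iff₀ (by positivity)]
    nlinarith
  set p := round ((k : ℝ) * θ)
  set η := (k : ℝ) * θ - p with hη
  rcases le_or_gt 0 η with h | h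
  · exact ⟨k, hk, p, h, (le_abs_self _).trans_lt hsmall⟩
  · have hhalf : |η| ≤ 1 / 2 := abs_sub_round _
    rw [abs_of_neg h] at hhalf hsmall
    set j := ⌊1 / (-η)⌋₊ with hj
    have hneg : 0 < -η := by linarith
    have hj1 : (j : ℝ) * (-η) ≤ 1 := by
      rw [← le_div_iff₀ hneg]
      exact Nat.floor_le (by positivity)
    have hj2 : 1 < ((j : ℝ) + 1) * (-η) := by
      rw [← div_lt_iff₀ hneg]
      exact Nat.lt_floor_add_one _
    have hj0 : 0 < j := by
      rw [hj, Nat.floor_pos, le_div_iff₀ hneg]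
      linarith
    refine ⟨j * k, Nat.mul_pos hj0 hk, j * p - 1, ?_, ?_⟩ <;>
    · have e : ((j * k : ℕ) : ℝ) * θ - ((j * p - 1 : ℤ) : ℝ) = 1 - j * (-η) := by
        push_cast
        rw [hη]
        ring
      rw [e]
      linarith

theorem exists_forall_floor_add_eq (θ ρ : ℝ) (l : ℕ) :
    ∃ ε > 0, ∀ t, 0 ≤ t → t < ε → ∀ k : ℕ, k ≤ l →
      ⌊(k : ℝ) * θ + (ρ + t)⌋ = ⌊(k : ℝ) * θ + ρ⌋ := by
  induction l with
  | zero =>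
    refine ⟨1 - Int.fract (((0 : ℕ) : ℝ) * θ + ρ), by linarith [Int.fract_lt_one (((0 : ℕ) : ℝ) * θ + ρ)],
      fun t h0 h1 k hk => ?_⟩
    obtain rfl : k = 0 := by omega
    rw [Int.floor_eq_iff]
    have := Int.floor_le (((0 : ℕ) : ℝ) * θ + ρ)
    unfold Int.fract at h1
    constructor <;> linarith
  | succ l ih =>
    obtain ⟨ε, hε, h⟩ := ih
    refine ⟨min ε (1 - Int.fract (((l + 1 : ℕ) : ℝ) * θ + ρ)),
      lt_min hε (by linarith [Int.fract_lt_one (((l + 1 : ℕ) : ℝ) * θ + ρ)]),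
      fun t h0 h1 k hk => ?_⟩
    rw [lt_min_iff] at h1
    rcases Nat.lt_or_ge k (l + 1) with hkl | hkl
    · exact h t h0 h1.1 k (by omega)
    · obtain rfl : k = l + 1 := by omega
      have h2 := h1.2
      rw [Int.floor_eq_iff]
      have := Int.floor_le (((l + 1 : ℕ) : ℝ) * θ + ρ)
      unfold Int.fract at h2
      constructor <;> linarith

theorem mechanicalWord_recurrent (θ ρ : ℝ) (l : ℕ) :
    ∃ r, 0 < r ∧ factor (mechanicalWord θ ρ) r l = factor (mechanicalWord θ ρ) 0 l := by
  obtain ⟨ε, hε, h⟩ := exists_forall_floor_add_eq θ ρ l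
  obtain ⟨r, hr, p, h0, h1⟩ := exists_nat_mul_sub_int_mem_Ico θ hε
  refine ⟨r, hr, ?_⟩
  rw [factor_mechanicalWord]
  refine factor_mechanicalWord_eq_of_floor (p := p) fun k hk => ?_
  rw [← h _ h0 h1 k hk, ← Int.floor_add_intCast]
  congr 1
  ring

end SturmianWords

section Powers

variable {A : Type*}

/-- The long prefixes of a periodic sequence are complete first returns to each other. -/
theorem isCompleteFirstReturn_factor_of_period {z : ℕ → A} {q l : ℕ} (hq : 0 < q)
    (hz : ∀ i, z (i + q) = z i) (hmin : ∀ r, 0 < r → r < q → ∃ i, z (i + r) ≠ z i) (hl : q ≤ l) :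
    IsCompleteFirstReturn (factor z 0 l) (factor z 0 (q + l)) := by
  refine isCompleteFirstReturn_factor hq ?_ fun r h0 hr he => ?_
  · rw [factor_eq_iff]
    intro i _
    rw [add_comm q i, hz, zero_add]
  · obtain ⟨i, hi⟩ := hmin r h0 hr
    rw [factor_eq_iff] at he
    have hmod : ∀ i, z (i % q) = z i := fun i => Function.Periodic.map_mod_nat hz i
    have h1 := he (i % q) ((Nat.mod_lt _ hq).trans_le hl)
    rw [zero_add, hmod] at h1
    apply hi
    rw [← h1, ← hmod (i + r), ← hmod (r + i % q)]
    congr 1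
    rw [add_comm r, Nat.mod_add_mod]

theorem exists_privileged_factor_of_period {z : ℕ → A} {q : ℕ} (hq : 0 < q)
    (hz : ∀ i, z (i + q) = z i) :
    ∃ l, q ≤ l ∧ l < 2 * q ∧ IsPrivileged (factor z 0 l) := by
  classical
  let P : ℕ → Prop := fun l => l < q ∧ IsPrivileged (factor z 0 l)
  have hP0 : P 0 := ⟨hq, by simpa [factor] using IsPrivileged.nil⟩
  have hP := Nat.findGreatest_spec (P := P) (Nat.zero_le q) hP0
  set l := Nat.findGreatest P q
  have hrec : factor z q l = factor z 0 l := by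
    rw [factor_eq_iff]
    intro i _
    rw [add_comm q i, hz, zero_add]
  obtain ⟨r, h0, -, h2, h3⟩ := exists_isCompleteFirstReturn_factor ⟨q, hq, hrec⟩
  have hrq := h2 q hq hrec
  have hpriv := IsPrivileged.step _ _ hP.2 h3
  have hlq := hP.1
  refine ⟨r + l, ?_, by omega, hpriv⟩
  by_contra! hcon
  have : r + l ≤ l := Nat.le_findGreatest hcon.le ⟨hcon, hpriv⟩
  omega

/-- A sequence always turning away from `ξ` as soon as it can. -/
theorem preferenceChoice_not_prefix {X : Subshift Bool ℕ} {ξ y : ℕ → Bool} (hy : y ∈ X.carrier)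
    {l L : ℕ} (hl : IsPrefixOfSeq (factor ξ 0 l) y) (hL : ¬ IsPrefixOfSeq (factor ξ 0 L) y)
    (w : language X) (hwl : w.1.length ≤ l) :
    ¬ IsPrefixOfSeq (factor ξ 0 L)
      ((preferenceChoice X fun w => !ξ w.length).toFun w).1 := by
  classical
  intro hcon
  have hex : ∃ n, y n ≠ ξ n := by
    by_contra! h
    exact hL (isPrefixOfSeq_factor.mpr fun i _ => by simpa using h i)
  set n := Nat.find hex with hn
  have hyn : y n ≠ ξ n := Nat.find_spec hex
  have hlt : ∀ i < n, y i = ξ i := fun i hi => not_not.mp (Nat.find_min hex hi)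
  rw [isPrefixOfSeq_factor] at hl hcon
  have hln : l ≤ n := by
    by_contra! h
    exact hyn (by simpa using hl n h)
  have hnL : n < L := by
    by_contra! h
    exact hL (isPrefixOfSeq_factor.mpr fun i hi => by simpa using hlt i (hi.trans_le h))
  have hf := (follows_preferenceChoice X (fun w => !ξ w.length) w).2 n (hwl.trans hln)
  have hpre : factor ((preferenceChoice X fun w => !ξ w.length).toFun w).1 0 n = factor y 0 n := by
    rw [factor_eq_iff]
    intro i hi
    rw [zero_add, hcon i (hi.trans hnL), zero_add]
    exact (hlt i hi).symm
  have hyn' : y n = !ξ n := by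
    revert hyn
    cases y n <;> cases ξ n <;> simp
  have hmem := factor_mem_language hy 0 (n + 1)
  rw [← factor_append_singleton, zero_add, hyn'] at hmem
  rw [hpre, nextLetter_eq (by simpa using hmem)] at hf
  have := hcon n hnL
  rw [hf] at this
  simp at this

theorem ofReal_sum_le_dSup {X : Subshift Bool ℕ} {δ : ℝ → ℝ} (hδ : IsLengthFunction δ)
    {ξ η : X.carrier} {ℓ : ℕ → ℕ} (hℓ : StrictMono ℓ) {m : ℕ}
    (hp : ∀ i ≤ m, IsPrivileged (factor ξ.1 0 (ℓ i)))
    (hc : ∀ i < m, IsCompleteFirstReturn (factor ξ.1 0 (ℓ i)) (factor ξ.1 0 (ℓ (i + 1))))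
    (hb : ∀ i < m, ∃ y ∈ X.carrier, IsPrefixOfSeq (factor ξ.1 0 (ℓ i)) y ∧
      ¬ IsPrefixOfSeq (factor ξ.1 0 (ℓ (i + 1))) y)
    (hη : ¬ IsPrefixOfSeq (factor ξ.1 0 (ℓ 1)) η.1) :
    ENNReal.ofReal (∑ i ∈ Finset.range m, δ (ℓ i)) ≤ dSup X δ ξ η := by
  set τ := preferenceChoice X fun w => !ξ.1 w.length with hτ
  have hpos : ∀ n : ℕ, 0 < δ n := fun n => hδ.pos _ (Nat.cast_nonneg _)
  have away : ∀ i < m, ∀ w : language X, w.1.length ≤ ℓ i →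
      ¬ IsPrefixOfSeq (factor ξ.1 0 (ℓ (i + 1))) (τ.toFun w).1 := by
    intro i hi w hwl
    obtain ⟨y, hy, h1, h2⟩ := hb i hi
    exact preferenceChoice_not_prefix hy h1 h2 w hwl
  have mono : ∀ {i j : ℕ} {x : ℕ → Bool}, i ≤ j → IsPrefixOfSeq (factor ξ.1 0 (ℓ j)) x →
      IsPrefixOfSeq (factor ξ.1 0 (ℓ i)) x := fun hij h =>
    isPrefixOfSeq_factor_mono (hℓ.monotone hij) h
  have short : ∀ (h : PrivilegedEdge X) (i : ℕ), i < m →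
      IsPrefixOfSeq (factor ξ.1 0 (ℓ (i + 1))) (τ.toFun ⟨h.src, h.src_mem⟩).1 →
      ¬ IsPrefixOfSeq (factor ξ.1 0 (ℓ (i + 1))) (τ.toFun ⟨h.tgt, h.tgt_mem⟩).1 →
      h.base.length ≤ ℓ i := by
    intro h i hi h1 h2
    simpa using h.base_privileged.length_le_of_separated (hp i hi.le) (hc i hi)
      (h.base_isPrefixOfSeq_src τ) (h.base_isPrefixOfSeq_tgt τ) h1 h2
  have single : ∀ (h : PrivilegedEdge X) (i j : ℕ), i < j → j < m →
      IsPrefixOfSeq (factor ξ.1 0 (ℓ (i + 1))) (τ.toFun ⟨h.src, h.src_mem⟩).1 →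
      ¬ IsPrefixOfSeq (factor ξ.1 0 (ℓ (i + 1))) (τ.toFun ⟨h.tgt, h.tgt_mem⟩).1 →
      ¬ IsPrefixOfSeq (factor ξ.1 0 (ℓ (j + 1))) (τ.toFun ⟨h.src, h.src_mem⟩).1 := by
    intro h i j hij hj h1 h2 h3
    have hbl := short h i (by omega) h1 h2
    have hs := τ.isPrefix ⟨h.src, h.src_mem⟩
    rcases le_or_gt h.src.length (ℓ (i + 1)) with hle | hgt
    · exact away (i + 1) (by omega) _ hle (mono (by omega) h3)
    · have hpre : factor ξ.1 0 (ℓ (i + 1)) <+: h.src :=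
        h1.prefix_of_length_le hs (by simpa using hgt.le)
      have := (hp (i + 1) (by omega)).length_le h.base_privileged h.src_return hpre
        (by simpa using hgt)
      have h4 := hℓ (Nat.lt_succ_self i)
      simp only [length_factor, Nat.succ_eq_add_one] at this h4
      omega
  let f : C(X.carrier, ℂ) := ∑ i ∈ Finset.range m,
    (δ (ℓ i) : ℂ) • cylinderIndicator X (factor ξ.1 0 (ℓ (i + 1)))
  have hfx : ∀ x, f x = ∑ i ∈ Finset.range m,
      (δ (ℓ i) : ℂ) * cylinderIndicator X (factor ξ.1 0 (ℓ (i + 1))) x := by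
    intro x
    simp [f]
  have hf : CommutatorNormLEOne δ τ f := by
    rw [commutatorNormLEOne_iff hδ]
    suffices main : ∀ (h : PrivilegedEdge X) (i : ℕ), i < m →
        IsPrefixOfSeq (factor ξ.1 0 (ℓ (i + 1))) (τ.toFun ⟨h.src, h.src_mem⟩).1 →
        ¬ IsPrefixOfSeq (factor ξ.1 0 (ℓ (i + 1))) (τ.toFun ⟨h.tgt, h.tgt_mem⟩).1 →
        (∀ j < i, (IsPrefixOfSeq (factor ξ.1 0 (ℓ (j + 1))) (τ.toFun ⟨h.src, h.src_mem⟩).1 ↔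
          IsPrefixOfSeq (factor ξ.1 0 (ℓ (j + 1))) (τ.toFun ⟨h.tgt, h.tgt_mem⟩).1)) →
        ‖f (τ.toFun ⟨h.src, h.src_mem⟩) - f (τ.toFun ⟨h.tgt, h.tgt_mem⟩)‖ ≤ h.len δ by
      intro h
      classical
      by_cases hex : ∃ i, i < m ∧
        ¬ (IsPrefixOfSeq (factor ξ.1 0 (ℓ (i + 1))) (τ.toFun ⟨h.src, h.src_mem⟩).1 ↔
          IsPrefixOfSeq (factor ξ.1 0 (ℓ (i + 1))) (τ.toFun ⟨h.tgt, h.tgt_mem⟩).1)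
      · have hlt : ∀ j < Nat.find hex,
            (IsPrefixOfSeq (factor ξ.1 0 (ℓ (j + 1))) (τ.toFun ⟨h.src, h.src_mem⟩).1 ↔
            IsPrefixOfSeq (factor ξ.1 0 (ℓ (j + 1))) (τ.toFun ⟨h.tgt, h.tgt_mem⟩).1) := by
          intro j hj
          have := Nat.find_min hex hj
          have h1 := (Nat.find_spec hex).1
          by_contra hcon
          exact this ⟨by omega, hcon⟩
        obtain ⟨him, hi⟩ := Nat.find_spec hex
        by_cases hs : IsPrefixOfSeq (factor ξ.1 0 (ℓ (Nat.find hex + 1)))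
          (τ.toFun ⟨h.src, h.src_mem⟩).1
        · exact main h _ him hs (fun ht => hi ⟨fun _ => ht, fun _ => hs⟩) hlt
        · have ht : IsPrefixOfSeq (factor ξ.1 0 (ℓ (Nat.find hex + 1)))
              (τ.toFun ⟨h.tgt, h.tgt_mem⟩).1 := by
            by_contra ht
            exact hi ⟨fun h => absurd h hs, fun h => absurd h ht⟩
          rw [norm_sub_rev]
          exact main h.op _ him ht hs fun j hj => (hlt j hj).symm
      · push Not at hex
        have : f (τ.toFun ⟨h.src, h.src_mem⟩) = f (τ.toFun ⟨h.tgt, h.tgt_mem⟩) := by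
          rw [hfx, hfx]
          refine Finset.sum_congr rfl fun i hi => ?_
          have hi' := hex i (Finset.mem_range.mp hi)
          by_cases hs : IsPrefixOfSeq (factor ξ.1 0 (ℓ (i + 1))) (τ.toFun ⟨h.src, h.src_mem⟩).1
          · rw [cylinderIndicator_of_prefix hs, cylinderIndicator_of_prefix (hi'.mp hs)]
          · rw [cylinderIndicator_of_not_prefix hs,
              cylinderIndicator_of_not_prefix fun ht => hs (hi'.mpr ht)]
        rw [this, sub_self, norm_zero]
        exact (h.len_pos hδ).le
    intro h i him hs ht hlt
    have hdiff : f (τ.toFun ⟨h.src, h.src_mem⟩) - f (τ.toFun ⟨h.tgt, h.tgt_mem⟩) = δ (ℓ i) := by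
      rw [hfx, hfx, ← Finset.sum_sub_distrib, Finset.sum_eq_single i]
      · rw [cylinderIndicator_of_prefix hs, cylinderIndicator_of_not_prefix ht]
        ring
      · intro j hj hji
        rw [Finset.mem_range] at hj
        rcases lt_or_gt_of_ne hji with hlt' | hgt
        · by_cases hsj : IsPrefixOfSeq (factor ξ.1 0 (ℓ (j + 1))) (τ.toFun ⟨h.src, h.src_mem⟩).1
          · rw [cylinderIndicator_of_prefix hsj,
              cylinderIndicator_of_prefix ((hlt j hlt').mp hsj), sub_self]
          · rw [cylinderIndicator_of_not_prefix hsj,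
              cylinderIndicator_of_not_prefix fun ht => hsj ((hlt j hlt').mpr ht), sub_self]
        · rw [cylinderIndicator_of_not_prefix (single h i j hgt hj hs ht),
            cylinderIndicator_of_not_prefix fun htj => ht (mono (by omega) htj), sub_self]
      · intro hi
        exact absurd (Finset.mem_range.mpr him) hi
    rw [hdiff, Complex.norm_real, Real.norm_of_nonneg (hpos _).le]
    exact hδ.anti (Nat.cast_nonneg _) (Nat.cast_le.mpr (short h i him hs ht))
  refine le_trans (le_of_eq ?_) ((enorm_sub_le_connesDist hf ξ η).trans
    (le_iSup (fun τ => connesDist δ τ ξ η) τ))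
  have h1 : f ξ = ((∑ i ∈ Finset.range m, δ (ℓ i) : ℝ) : ℂ) := by
    rw [hfx]
    push_cast
    refine Finset.sum_congr rfl fun i _ => ?_
    rw [cylinderIndicator_of_prefix (isPrefixOfSeq_factor_self _ _), mul_one]
  have h2 : f η = 0 := by
    rw [hfx]
    refine Finset.sum_eq_zero fun i _ => ?_
    rw [cylinderIndicator_of_not_prefix fun h => hη (mono (by omega) h), mul_zero]
  rw [h1, h2, sub_zero, ← ofReal_norm, Complex.norm_real,
    Real.norm_of_nonneg (Finset.sum_nonneg fun i _ => (hpos _).le)]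

end Powers

/-- The distance of `θ` to a rational number of denominator `q` is at least a constant
times `q⁻²`. -/
def IsBadlyApproximable (θ : ℝ) : Prop :=
  ∃ c > 0, ∀ r : ℚ, c / (r.den : ℝ) ^ 2 ≤ |θ - r|

section Powers

theorem floor_jump_unique {x ε : ℝ} {K : ℕ} (hK : K * |ε| < 1) {j j' : ℕ} (hj : j < K)
    (hj' : j' < K) (h : ⌊x + ((j : ℝ) + 1) * ε⌋ ≠ ⌊x + (j : ℝ) * ε⌋)
    (h' : ⌊x + ((j' : ℝ) + 1) * ε⌋ ≠ ⌊x + (j' : ℝ) * ε⌋) : j = j' := by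
  wlog hlt : j < j' generalizing j j'
  · rcases Nat.lt_or_ge j' j with h1 | h1
    · exact (this hj' hj h' h h1).symm
    · omega
  exfalso
  have a1 : ((j : ℝ) + 1) ≤ j' := by exact_mod_cast hlt
  have a2 : ((j' : ℝ) + 1) ≤ K := by exact_mod_cast hj'
  have a3 : (0 : ℝ) ≤ j := Nat.cast_nonneg _
  rcases le_total 0 ε with hε | hε
  · rw [abs_of_nonneg hε] at hK
    have m1 : ⌊x + (j : ℝ) * ε⌋ ≤ ⌊x + ((j : ℝ) + 1) * ε⌋ := Int.floor_le_floor (by linarith)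
    have m2 : ⌊x + ((j : ℝ) + 1) * ε⌋ ≤ ⌊x + (j' : ℝ) * ε⌋ := Int.floor_le_floor (by gcongr)
    have m3 : ⌊x + (j' : ℝ) * ε⌋ ≤ ⌊x + ((j' : ℝ) + 1) * ε⌋ := Int.floor_le_floor (by linarith)
    have m4 : ⌊x + (j : ℝ) * ε⌋ + 2 ≤ ⌊x + ((j' : ℝ) + 1) * ε⌋ := by omega
    have m5 : (⌊x + (j : ℝ) * ε⌋ : ℝ) + 2 ≤ ⌊x + ((j' : ℝ) + 1) * ε⌋ := by exact_mod_cast m4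
    have b1 := Int.lt_floor_add_one (x + (j : ℝ) * ε)
    have b2 := Int.floor_le (x + ((j' : ℝ) + 1) * ε)
    nlinarith
  · rw [abs_of_nonpos hε] at hK
    have m1 : ⌊x + ((j : ℝ) + 1) * ε⌋ ≤ ⌊x + (j : ℝ) * ε⌋ := Int.floor_le_floor (by linarith)
    have m2 : ⌊x + (j' : ℝ) * ε⌋ ≤ ⌊x + ((j : ℝ) + 1) * ε⌋ := Int.floor_le_floor (by nlinarith)
    have m3 : ⌊x + ((j' : ℝ) + 1) * ε⌋ ≤ ⌊x + (j' : ℝ) * ε⌋ := Int.floor_le_floor (by linarith)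
    have m4 : ⌊x + ((j' : ℝ) + 1) * ε⌋ + 2 ≤ ⌊x + (j : ℝ) * ε⌋ := by omega
    have m5 : (⌊x + ((j' : ℝ) + 1) * ε⌋ : ℝ) + 2 ≤ ⌊x + (j : ℝ) * ε⌋ := by exact_mod_cast m4
    have b1 := Int.lt_floor_add_one (x + ((j' : ℝ) + 1) * ε)
    have b2 := Int.floor_le (x + (j : ℝ) * ε)
    nlinarith

/-- If `qθ` is very close to an integer, then some mechanical word begins with a long block of
period `q`. -/
theorem exists_mechanicalWord_period {θ ε : ℝ} {q M : ℕ} {p : ℤ} (h : (q : ℝ) * θ = p + ε)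
    (hM : (M + 2 : ℕ) * |ε| < 1) :
    ∃ ρ, ∀ i < M, mechanicalWord θ ρ (i + q) = mechanicalWord θ ρ i := by
  classical
  let bad : ℕ → Finset ℕ := fun i => (Finset.range (M + 2)).filter fun j : ℕ =>
    ⌊(i : ℝ) * θ + ((j : ℝ) + 1) * ε⌋ ≠ ⌊(i : ℝ) * θ + (j : ℝ) * ε⌋
  have hbad : ∀ i, (bad i).card ≤ 1 := by
    intro i
    rw [Finset.card_le_one]
    intro j hj j' hj'
    simp only [bad, Finset.mem_filter, Finset.mem_range] at hj hj'
    exact floor_jump_unique hM hj.1 hj'.1 hj.2 hj'.2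
  have hcard : ((Finset.range (M + 1)).biUnion bad).card < (Finset.range (M + 2)).card := by
    refine (Finset.card_biUnion_le_card_mul _ _ 1 fun i _ => hbad i).trans_lt ?_
    simp
  obtain ⟨j, hj, hjbad⟩ := Finset.exists_mem_notMem_of_card_lt_card hcard
  have good : ∀ i ≤ M, ⌊(i : ℝ) * θ + ((j : ℝ) + 1) * ε⌋ = ⌊(i : ℝ) * θ + (j : ℝ) * ε⌋ := by
    intro i hi
    by_contra hcon
    refine hjbad (Finset.mem_biUnion.mpr ⟨i, Finset.mem_range.mpr (by omega), ?_⟩)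
    exact Finset.mem_filter.mpr ⟨hj, hcon⟩
  refine ⟨j * ε, fun i hi => ?_⟩
  rw [add_comm i q, mechanicalWord_add, h]
  refine mechanicalWord_eq_of_floor (p := p) ?_ ?_
  · rw [← good i hi.le, ← Int.floor_add_intCast]
    congr 1
    ring
  · have := good (i + 1) hi
    push_cast at this
    rw [← this, ← Int.floor_add_intCast]
    congr 1
    ring

/-- If `θ` is not badly approximable, then the language contains arbitrarily high powers. -/
theorem exists_power_mem_language {θ : ℝ} (h : ¬ IsBadlyApproximable θ) (N : ℕ) :
    ∃ (z : ℕ → Bool) (q : ℕ), 0 < q ∧ (∀ i, z (i + q) = z i) ∧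
      factor z 0 (N * q) ∈ language (sturmianSubshift θ) := by
  simp only [IsBadlyApproximable, not_exists, not_and, not_forall, not_le] at h
  obtain ⟨r, hr⟩ := h (1 / (N + 2)) (by positivity)
  have hq : (0 : ℝ) < r.den := by exact_mod_cast r.den_pos
  have hq1 : (1 : ℝ) ≤ r.den := by exact_mod_cast r.den_pos
  have hnum : (r : ℝ) * r.den = r.num := by exact_mod_cast Rat.mul_den_eq_num r
  obtain ⟨ρ, hρ⟩ := exists_mechanicalWord_period (θ := θ) (q := r.den) (M := N * r.den)
    (p := r.num) (ε := (θ - r) * r.den) (by rw [← hnum]; ring) (by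
      rw [abs_mul, Nat.abs_cast]
      rw [lt_div_iff₀ (by positivity), lt_div_iff₀ (by positivity)] at hr
      push_cast
      have h1 : 0 ≤ |θ - r| * r.den := by positivity
      nlinarith)
  set s := mechanicalWord θ ρ
  have key : ∀ i, i < N * r.den → s (i % r.den) = s i := by
    intro i
    induction i using Nat.strong_induction_on with
    | _ i ih =>
      intro hi
      rcases Nat.lt_or_ge i r.den with h1 | h1
      · rw [Nat.mod_eq_of_lt h1]
      · have h2 := ih (i - r.den) (by have := r.den_pos; omega) (by omega)
        have h3 := hρ (i - r.den) (by omega)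
        rw [Nat.sub_add_cancel h1] at h3
        rw [h3, ← h2, ← Nat.mod_eq_sub_mod h1]
  refine ⟨fun i => s (i % r.den), r.den, r.den_pos, fun i => by simp, ?_⟩
  rw [mem_language_sturmianSubshift_iff]
  refine ⟨ρ, isPrefixOfSeq_factor.mpr fun i hi => ?_⟩
  rw [zero_add, key i hi]

/-- A word with a long period does not determine its periodic continuation. -/
theorem exists_mechanicalWord_branching {θ : ℝ} (hθ : Irrational θ) {z : ℕ → Bool} {q l : ℕ}
    (hq : 0 < q) (hz : ∀ i, z (i + q) = z i) (hl : q ≤ l)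
    (hmem : factor z 0 l ∈ language (sturmianSubshift θ)) :
    ∃ ρ, IsPrefixOfSeq (factor z 0 l) (mechanicalWord θ ρ) ∧
      ¬ IsPrefixOfSeq (factor z 0 (l + q)) (mechanicalWord θ ρ) := by
  by_contra! hcon
  obtain ⟨ρ, hρ⟩ := mem_language_sturmianSubshift_iff.mp hmem
  have hall : ∀ n : ℕ, IsPrefixOfSeq (factor z 0 l) (mechanicalWord θ ((n * q : ℕ) * θ + ρ)) := by
    intro n
    induction n with
    | zero => simpa using hρ
    | succ n ih =>
      have h1 := isPrefixOfSeq_factor.mp (hcon _ ih)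
      rw [isPrefixOfSeq_factor]
      intro i hi
      have h2 := h1 (q + i) (by omega)
      rw [← mechanicalWord_add] at h2 ⊢
      rw [show (n + 1) * q + i = n * q + (q + i) by ring, h2, zero_add, zero_add, add_comm q, hz]
  have hsz : ∀ i, mechanicalWord θ ρ i = z i := by
    intro i
    have h1 := isPrefixOfSeq_factor.mp (hall (i / q)) (i % q) ((Nat.mod_lt _ hq).trans_le hl)
    rw [← mechanicalWord_add, Nat.div_add_mod', zero_add] at h1
    rw [h1]
    exact Function.Periodic.map_mod_nat hz i
  obtain ⟨i, hi⟩ := mechanicalWord_not_periodic hθ ρ q hq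
  exact hi (by rw [hsz, hsz, hz])

theorem isBadlyApproximable_of_lipschitzEquivalent {θ : ℝ} (hθ : Irrational θ) {δ : ℝ → ℝ}
    (hδ : IsLengthFunction δ) (hδ' : ∃ c > 0, ∃ R : ℝ, ∀ a ≥ R, c * δ a ≤ δ (2 * a))
    (h : LipschitzEquivalent (dInf (sturmianSubshift θ) δ) (dSup (sturmianSubshift θ) δ)) :
    IsBadlyApproximable θ := by
  classical
  by_contra hbad
  obtain ⟨C, -, hC⟩ := h
  obtain ⟨c, hc, R, hR⟩ := hδ'
  obtain ⟨m, hm⟩ := exists_nat_gt (max (C / c) (max R 0))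
  rw [max_lt_iff, max_lt_iff] at hm
  obtain ⟨hmC, hmR, hm0⟩ := hm
  have hm0 : 0 < m := by exact_mod_cast hm0
  obtain ⟨z, q₀, hq₀, hz₀, hmem₀⟩ := exists_power_mem_language hbad (2 * m + 2)
  have hex : ∃ q, 0 < q ∧ ∀ i, z (i + q) = z i := ⟨q₀, hq₀, hz₀⟩
  set q := Nat.find hex with hqdef
  obtain ⟨hq, hz⟩ : 0 < q ∧ ∀ i, z (i + q) = z i := Nat.find_spec hex
  have hqq₀ : q ≤ q₀ := Nat.find_min' hex ⟨hq₀, hz₀⟩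
  have hmin : ∀ r, 0 < r → r < q → ∃ i, z (i + r) ≠ z i := by
    intro r h0 hr
    by_contra! hcon
    exact Nat.find_min hex hr ⟨h0, hcon⟩
  have hmem : ∀ l ≤ (2 * m + 2) * q, factor z 0 l ∈ language (sturmianSubshift θ) := by
    intro l hl
    obtain ⟨x, hx, hxp⟩ := mem_language_iff.mp hmem₀
    refine mem_language_of_isPrefixOfSeq hx (isPrefixOfSeq_factor_mono ?_ hxp)
    exact hl.trans (Nat.mul_le_mul_left _ hqq₀)
  obtain ⟨l₀, hl1, hl2, hpriv⟩ := exists_privileged_factor_of_period hq hz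
  let ℓ : ℕ → ℕ := fun i => l₀ + i * q
  have hℓ : StrictMono ℓ := strictMono_nat_of_lt_succ fun n => by
    simp only [ℓ]
    rw [Nat.succ_mul]
    omega
  have hqℓ : ∀ i, q ≤ ℓ i := fun i => hl1.trans (Nat.le_add_right _ _)
  have hsucc : ∀ i, ℓ (i + 1) = q + ℓ i := fun i => by
    simp only [ℓ]
    ring
  have hcfr : ∀ i, IsCompleteFirstReturn (factor z 0 (ℓ i)) (factor z 0 (ℓ (i + 1))) := by
    intro i
    rw [hsucc]
    exact isCompleteFirstReturn_factor_of_period hq hz hmin (hqℓ i)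
  have hp : ∀ i, IsPrivileged (factor z 0 (ℓ i)) := by
    intro i
    induction i with
    | zero => simpa [ℓ] using hpriv
    | succ i ih => exact IsPrivileged.step _ _ ih (hcfr i)
  have hℓle : ∀ i ≤ 2 * m, ℓ i ≤ (2 * m + 2) * q := by
    intro i hi
    have : i * q ≤ 2 * m * q := Nat.mul_le_mul_right _ hi
    simp only [ℓ]
    rw [add_mul]
    omega
  have hbranch : ∀ i ≤ 2 * m, ∃ ρ, IsPrefixOfSeq (factor z 0 (ℓ i)) (mechanicalWord θ ρ) ∧
      ¬ IsPrefixOfSeq (factor z 0 (ℓ (i + 1))) (mechanicalWord θ ρ) := by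
    intro i hi
    rw [hsucc, add_comm]
    exact exists_mechanicalWord_branching hθ hq hz (hqℓ i) (hmem _ (hℓle i hi))
  obtain ⟨ξ, hξ, hξz⟩ := mem_language_iff.mp (hmem _ (hℓle (2 * m) le_rfl))
  have hξz' : ∀ i ≤ 2 * m, factor ξ 0 (ℓ i) = factor z 0 (ℓ i) := by
    intro i hi
    have := isPrefixOfSeq_factor_mono (hℓ.monotone hi) hξz
    rwa [IsPrefixOfSeq, length_factor] at this
  obtain ⟨ρ, hρ1, hρ2⟩ := hbranch m (by omega)
  set η := mechanicalWord θ ρ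
  have hη := mechanicalWord_mem θ ρ
  have upper : dInf (sturmianSubshift θ) δ ⟨ξ, hξ⟩ ⟨η, hη⟩ ≤ ENNReal.ofReal (δ (ℓ m)) := by
    obtain ⟨r, h0, -, -, hr⟩ := exists_isCompleteFirstReturn_factor
      (mechanicalWord_recurrent θ ρ (ℓ m))
    have e : factor (mechanicalWord θ ρ) 0 (ℓ m) = factor z 0 (ℓ m) := by
      rwa [IsPrefixOfSeq, length_factor] at hρ1
    rw [e] at hr
    have := dInf_le_ofReal_length (X := sturmianSubshift θ) hδ (ξ := ⟨ξ, hξ⟩) (η := ⟨η, hη⟩)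
      (hp m) (hcfr m) hr (fun e => hρ2 (by rw [e]; exact isPrefixOfSeq_factor_self _ _))
      (isPrefixOfSeq_factor_mono (hℓ.monotone (by omega)) hξz) (isPrefixOfSeq_factor_self _ _)
    simpa using this
  have lower := ofReal_sum_le_dSup (X := sturmianSubshift θ) hδ (ξ := ⟨ξ, hξ⟩) (η := ⟨η, hη⟩)
    (ℓ := fun i => ℓ (m + i)) (fun i j hij => hℓ (by omega)) (m := m)
    (fun i hi => by rw [hξz' _ (by omega)]; exact hp _)
    (fun i hi => by
      rw [hξz' _ (by omega), hξz' (m + (i + 1)) (by omega)]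
      exact hcfr _)
    (fun i hi => by
      obtain ⟨ρ', h1, h2⟩ := hbranch (m + i) (by omega)
      rw [hξz' _ (by omega), hξz' (m + (i + 1)) (by omega)]
      exact ⟨_, mechanicalWord_mem θ ρ', h1, h2⟩)
    (by rw [hξz' _ (by omega)]; exact hρ2)
  have hmℓ : (m : ℝ) ≤ ℓ m := by
    have : m * 1 ≤ m * q := Nat.mul_le_mul_left _ hq
    exact_mod_cast (by simp only [ℓ]; omega : m ≤ ℓ m)
  have hδpos : 0 < δ (ℓ m) := hδ.pos _ (Nat.cast_nonneg _)
  have hsum : m * (c * δ (ℓ m)) ≤ ∑ i ∈ Finset.range m, δ (ℓ (m + i)) := by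
    have := Finset.card_nsmul_le_sum (Finset.range m) (fun i => δ (ℓ (m + i))) (c * δ (ℓ m)) ?_
    · simpa using this
    · intro i hi
      refine (hR (ℓ m) (hmR.le.trans hmℓ)).trans (hδ.anti (Nat.cast_nonneg _) ?_)
      have h1 : i * q ≤ m * q := Nat.mul_le_mul_right _ (Finset.mem_range.mp hi).le
      have h2 : ℓ (m + i) ≤ 2 * ℓ m := by
        simp only [ℓ]
        rw [add_mul]
        omega
      exact_mod_cast h2
  have final : ENNReal.ofReal (m * (c * δ (ℓ m))) ≤ ENNReal.ofReal (C * δ (ℓ m)) :=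
    calc _ ≤ _ := ENNReal.ofReal_le_ofReal hsum
      _ ≤ _ := lower
      _ ≤ C * dInf (sturmianSubshift θ) δ ⟨ξ, hξ⟩ ⟨η, hη⟩ := (hC _ _).2
      _ ≤ C * ENNReal.ofReal (δ (ℓ m)) := by gcongr
      _ = _ := by rw [ENNReal.ofReal_mul C.coe_nonneg, ENNReal.ofReal_coe_nnreal]
  rw [ENNReal.ofReal_le_ofReal_iff (by positivity), ← mul_assoc] at final
  have := le_of_mul_le_mul_right final hδpos
  rw [div_lt_iff₀ hc] at hmC
  linarith

end Powers

section LinearRepetitivity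

theorem exists_nat_mul_sub_int_mem_of_badlyApproximable {θ c : ℝ} (hc : 0 < c)
    (h : ∀ r : ℚ, c / (r.den : ℝ) ^ 2 ≤ |θ - r|) {Q : ℕ} (hQ : 0 < Q) (a : ℝ) :
    ∃ k ≤ Q, ∃ t : ℤ, a ≤ (k : ℝ) * θ - t ∧ (k : ℝ) * θ - t < a + (2 + 1 / c) / (Q + 1) := by
  obtain ⟨r, hr, hden⟩ := Real.exists_rat_abs_sub_le_and_den_le θ hQ
  have hq : (0 : ℝ) < r.den := by exact_mod_cast r.den_pos
  have hQ1 : (0 : ℝ) < Q + 1 := by positivity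
  have hlow : 1 / (r.den : ℝ) ≤ 1 / c / (Q + 1) := by
    have h1 := (h r).trans hr
    rw [div_le_div_iff₀ (by positivity) (by positivity)] at h1
    rw [div_div, div_le_div_iff₀ hq (by positivity)]
    have h2 : c * (Q + 1) * r.den ≤ r.den * r.den := by nlinarith
    have := le_of_mul_le_mul_right h2 hq
    linarith
  set M : ℤ := ⌈(r.den : ℝ) * (a + 1 / (Q + 1))⌉ with hM
  have hM1 : a + 1 / (Q + 1) ≤ M / r.den := by
    rw [le_div_iff₀ hq, mul_comm]
    exact Int.le_ceil _
  have hM2 : (M : ℝ) / r.den < a + 1 / (Q + 1) + 1 / r.den := by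
    rw [div_lt_iff₀ hq, add_mul, div_mul_cancel₀ _ hq.ne', mul_comm _ (r.den : ℝ)]
    exact Int.ceil_lt_add_one _
  obtain ⟨x, y, hxy⟩ : IsCoprime r.num (r.den : ℤ) := r.isCoprime_num_den
  have hdz : (0 : ℤ) < r.den := by exact_mod_cast r.den_pos
  set k : ℤ := (x * M) % r.den with hk
  have hk0 : 0 ≤ k := Int.emod_nonneg _ hdz.ne'
  have hk1 : k < r.den := Int.emod_lt_of_pos _ hdz
  have hkt : k * r.num = M + r.den * (-(x * M / r.den) * r.num - y * M) := by
    have := Int.emod_add_mul_ediv (x * M) r.den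
    rw [← hk] at this
    linear_combination r.num * this + M * hxy
  set t : ℤ := -(x * M / r.den) * r.num - y * M
  refine ⟨k.toNat, by omega, t, ?_⟩
  have hkr : ((k.toNat : ℕ) : ℝ) = (k : ℝ) := by
    have : ((k.toNat : ℕ) : ℤ) = k := Int.toNat_of_nonneg hk0
    exact_mod_cast this
  have hnum : (r : ℝ) * r.den = r.num := by exact_mod_cast Rat.mul_den_eq_num r
  have hkt' : (k : ℝ) * r.num = M + r.den * t := by exact_mod_cast hkt
  have hkR0 : (0 : ℝ) ≤ k := by exact_mod_cast hk0
  have hkR1 : (k : ℝ) ≤ r.den := by exact_mod_cast hk1.le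
  have e : (k : ℝ) * θ - t = k * (θ - r) + M / r.den := by
    field_simp
    linear_combination hkt' + (k : ℝ) * hnum
  have herr : |(k : ℝ) * (θ - r)| ≤ 1 / (Q + 1) := by
    rw [abs_mul, abs_of_nonneg hkR0]
    calc (k : ℝ) * |θ - r| ≤ r.den * (1 / ((Q + 1) * r.den)) := by gcongr
      _ = 1 / (Q + 1) := by field_simp
  rw [abs_le] at herr
  rw [hkr, e]
  have e2 : (2 + 1 / c) / ((Q : ℝ) + 1) = 1 / (Q + 1) + 1 / (Q + 1) + 1 / c / (Q + 1) := by ring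
  rw [e2]
  constructor <;> linarith

theorem div_le_abs_mul_sub_of_badlyApproximable {θ c : ℝ} (hc : 0 < c)
    (h : ∀ r : ℚ, c / (r.den : ℝ) ^ 2 ≤ |θ - r|) {d : ℤ} (hd : d ≠ 0) (P : ℤ) :
    c / |(d : ℝ)| ≤ |(d : ℝ) * θ - P| := by
  have hd' : (d : ℝ) ≠ 0 := by exact_mod_cast hd
  have hpos : 0 < |(d : ℝ)| := abs_pos.mpr hd'
  have hden : (((P : ℚ) / (d : ℚ)).den : ℝ) ≤ |(d : ℝ)| := by
    have h1 : ((P : ℚ) / (d : ℚ)).den ∣ d.natAbs := by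
      have := Rat.den_dvd P d
      rw [Rat.divInt_eq_div] at this
      exact Int.natCast_dvd.mp this
    have h2 := Nat.le_of_dvd (Int.natAbs_pos.mpr hd) h1
    have h3 : ((d.natAbs : ℕ) : ℝ) = |(d : ℝ)| := by
      rw [Nat.cast_natAbs, Int.cast_abs]
    rw [← h3]
    exact_mod_cast h2
  have hden0 : (0 : ℝ) < ((P : ℚ) / (d : ℚ)).den := by exact_mod_cast Rat.den_pos _
  have h4 : c / |(d : ℝ)| ^ 2 ≤ |θ - P / d| := by
    refine le_trans ?_ ((h ((P : ℚ) / (d : ℚ))).trans_eq (by push_cast; rfl))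
    gcongr
  have h5 : (d : ℝ) * θ - P = d * (θ - P / d) := by field_simp
  rw [h5, abs_mul]
  calc c / |(d : ℝ)| = |(d : ℝ)| * (c / |(d : ℝ)| ^ 2) := by field_simp
    _ ≤ _ := by gcongr

/-- The intercepts giving a mechanical word with a prescribed prefix of length `n` contain an
interval of length proportional to `1 / n`. -/
theorem exists_forall_floor_eq_of_badlyApproximable {θ c : ℝ} (hc : 0 < c)
    (h : ∀ r : ℚ, c / (r.den : ℝ) ^ 2 ≤ |θ - r|) (ρ : ℝ) {n : ℕ} (hn : 0 < n) :
    ∃ a, ∀ ρ', a ≤ ρ' → ρ' < a + min 1 c / n → ∀ k : ℕ, k ≤ n →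
      ⌊(k : ℝ) * θ + ρ'⌋ = ⌊(k : ℝ) * θ + ρ⌋ := by
  have hnR : (1 : ℝ) ≤ n := by exact_mod_cast hn
  obtain ⟨i, hi, hmax⟩ := Finset.exists_max_image (Finset.range (n + 1))
    (fun k : ℕ => ρ - Int.fract ((k : ℝ) * θ + ρ)) ⟨0, by simp⟩
  rw [Finset.mem_range] at hi
  refine ⟨ρ - Int.fract ((i : ℝ) * θ + ρ), fun ρ' h0 h1 k hk => ?_⟩
  have h2 := hmax k (Finset.mem_range.mpr (by omega))
  have fi := Int.self_sub_floor ((i : ℝ) * θ + ρ)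
  have fk := Int.self_sub_floor ((k : ℝ) * θ + ρ)
  rw [Int.floor_eq_iff]
  refine ⟨by linarith, ?_⟩
  suffices hD : min 1 c / n ≤ 1 + Int.fract ((i : ℝ) * θ + ρ) - Int.fract ((k : ℝ) * θ + ρ) by
    linarith
  have hDpos : 0 ≤ 1 + Int.fract ((i : ℝ) * θ + ρ) - Int.fract ((k : ℝ) * θ + ρ) := by
    linarith [Int.fract_nonneg ((i : ℝ) * θ + ρ), Int.fract_lt_one ((k : ℝ) * θ + ρ)]
  by_cases hik : i = k
  · subst hik
    rw [add_sub_cancel_right, div_le_one (by positivity)]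
    exact (min_le_left _ _).trans hnR
  · have hd : ((i : ℤ) - k) ≠ 0 := by omega
    have h3 := div_le_abs_mul_sub_of_badlyApproximable hc h hd
      (⌊(i : ℝ) * θ + ρ⌋ - ⌊(k : ℝ) * θ + ρ⌋ - 1)
    have e : (((i : ℤ) - k : ℤ) : ℝ) * θ -
        ((⌊(i : ℝ) * θ + ρ⌋ - ⌊(k : ℝ) * θ + ρ⌋ - 1 : ℤ) : ℝ) =
        1 + Int.fract ((i : ℝ) * θ + ρ) - Int.fract ((k : ℝ) * θ + ρ) := by
      rw [← fi, ← fk]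
      push_cast
      ring
    rw [e, abs_of_nonneg hDpos] at h3
    refine le_trans ?_ h3
    have habs : |(((i : ℤ) - k : ℤ) : ℝ)| ≤ n := by
      have : |(i : ℤ) - k| ≤ n := by rw [abs_le]; omega
      exact_mod_cast this
    have hpos : 0 < |(((i : ℤ) - k : ℤ) : ℝ)| := abs_pos.mpr (by exact_mod_cast hd)
    gcongr
    exact min_le_right _ _

theorem IsBadlyApproximable.isLinearlyRepetitive {θ : ℝ} (h : IsBadlyApproximable θ) :
    IsLinearlyRepetitive (sturmianSubshift θ) := by
  obtain ⟨c, hc, h⟩ := h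
  have hc' : 0 < min 1 c := lt_min one_pos hc
  refine ⟨(2 + 1 / c) / min 1 c + 2, fun u hu w hw hlen => ?_⟩
  rcases Nat.eq_zero_or_pos u.length with h0 | hn
  · rw [List.length_eq_zero_iff.mp h0]
    exact List.nil_infix
  obtain ⟨ρ, hρ⟩ := mem_language_sturmianSubshift_iff.mp hu
  obtain ⟨σ, hσ⟩ := mem_language_sturmianSubshift_iff.mp hw
  obtain ⟨a, ha⟩ := exists_forall_floor_eq_of_badlyApproximable hc h ρ hn
  set n := u.length
  have hnR : (1 : ℝ) ≤ n := by exact_mod_cast hn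
  set D : ℝ := (2 + 1 / c) / min 1 c with hD
  have hDpos : 0 < D := by positivity
  set Q : ℕ := ⌈D * n⌉₊ with hQdef
  have hQ0 : 0 < Q := Nat.ceil_pos.mpr (by positivity)
  have hQ1 : D * n ≤ Q := Nat.le_ceil _
  have hQ2 : (Q : ℝ) < D * n + 1 := Nat.ceil_lt_add_one (by positivity)
  obtain ⟨k, hkQ, t, h1, h2⟩ :=
    exists_nat_mul_sub_int_mem_of_badlyApproximable hc h hQ0 (a - σ)
  have hgap : (2 + 1 / c) / (Q + 1) ≤ min 1 c / n := by
    rw [div_le_div_iff₀ (by positivity) (by positivity)]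
    have : D * min 1 c = 2 + 1 / c := div_mul_cancel₀ _ hc'.ne'
    rw [← this]
    nlinarith
  have hfac : factor (mechanicalWord θ σ) k n = u := by
    rw [factor_mechanicalWord, ← (hρ : factor (mechanicalWord θ ρ) 0 n = u)]
    refine factor_mechanicalWord_eq_of_floor (p := t) fun j hj => ?_
    rw [← ha (k * θ - t + σ) (by linarith) (by linarith) j hj, ← Int.floor_add_intCast]
    congr 1
    ring
  have hkn : k + n ≤ w.length := by
    have hkR : (k : ℝ) ≤ Q := by exact_mod_cast hkQ
    have : (k : ℝ) + n ≤ w.length := by nlinarith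
    exact_mod_cast this
  rw [← hfac, ← (hσ : factor (mechanicalWord θ σ) 0 w.length = w)]
  exact factor_infix_factor _ (Nat.zero_le _) (by omega)

end LinearRepetitivity

section ContinuedFractions

open GenContFract

theorem exists_int_contsAux_eq (θ : ℝ) (n : ℕ) :
    (∃ a b : ℤ, (GenContFract.of θ).contsAux n = ⟨a, b⟩) ∧
      ∃ a b : ℤ, (GenContFract.of θ).contsAux (n + 1) = ⟨a, b⟩ := by
  induction n with
  | zero =>
    refine ⟨⟨1, 0, ?_⟩, ⟨⌊θ⌋, 1, ?_⟩⟩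
    · simp [zeroth_contAux_eq_one_zero]
    · simp [first_contAux_eq_h_one]
  | succ n ih =>
    refine ⟨ih.2, ?_⟩
    obtain ⟨⟨a, b, h1⟩, a', b', h2⟩ := ih
    rcases hs : (GenContFract.of θ).s.get? n with - | gp
    · refine ⟨a', b', ?_⟩
      rw [← h2]
      exact contsAux_stable_step_of_terminated hs
    · obtain ⟨hgp, z, hz⟩ := of_partNum_eq_one_and_exists_int_partDen_eq hs
      refine ⟨z * a' + a, z * b' + b, ?_⟩
      rw [contsAux_recurrence hs h1 h2, hgp, hz]
      push_cast
      ring_nf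

theorem exists_int_nums_dens_eq (θ : ℝ) (n : ℕ) :
    ∃ a b : ℤ, (GenContFract.of θ).nums n = a ∧ (GenContFract.of θ).dens n = b := by
  obtain ⟨a, b, h⟩ := (exists_int_contsAux_eq θ n).2
  refine ⟨a, b, ?_, ?_⟩
  · rw [num_eq_conts_a, nth_cont_eq_succ_nth_contAux, h]
  · rw [den_eq_conts_b, nth_cont_eq_succ_nth_contAux, h]

theorem not_terminatedAt_of_irrational {θ : ℝ} (hθ : Irrational θ) (n : ℕ) :
    ¬ (GenContFract.of θ).TerminatedAt n := by
  intro h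
  obtain ⟨q, hq⟩ := (terminates_iff_rat θ).mp ⟨n, h⟩
  exact hθ ⟨q, hq.symm⟩

theorem one_le_dens_of_irrational {θ : ℝ} (hθ : Irrational θ) (n : ℕ) :
    1 ≤ (GenContFract.of θ).dens n := by
  refine le_trans ?_ (succ_nth_fib_le_of_nth_den (Or.inr (not_terminatedAt_of_irrational hθ _)))
  exact_mod_cast Nat.fib_pos.mpr (Nat.succ_pos n)

theorem hasBoundedCoefficients_of_isBadlyApproximable {θ : ℝ} (hθ : Irrational θ)
    (h : IsBadlyApproximable θ) : HasBoundedCoefficients θ := by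
  obtain ⟨c, hc, h⟩ := h
  refine ⟨1 / c, fun n b hb => ?_⟩
  obtain ⟨A, B, hA, hB⟩ := exists_int_nums_dens_eq θ n
  have hB1 := one_le_dens_of_irrational hθ n
  have hb1 := of_one_le_get?_partDen hb
  have hle := abs_sub_convergents_le' hb
  rw [conv_eq_num_div_den, hA, hB] at hle
  rw [hB] at hB1
  have hB0 : B ≠ 0 := by
    rintro rfl
    norm_num at hB1
  have h1 := div_le_abs_mul_sub_of_badlyApproximable hc h hB0 A
  have h2 : (B : ℝ) * θ - A = B * (θ - A / B) := by field_simp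
  rw [h2, abs_mul, abs_of_pos (by linarith : (0 : ℝ) < B)] at h1
  have h3 : c / B ≤ B * (1 / (b * B * B)) := h1.trans (by gcongr)
  have h4 : (B : ℝ) * (1 / (b * B * B)) = 1 / b / B := by
    field_simp
  rw [h4, div_le_div_iff_of_pos_right (by linarith)] at h3
  rw [le_div_iff₀ (by linarith)] at h3 ⊢
  linarith

theorem HasBoundedCoefficients.isBadlyApproximable {θ : ℝ} (hθ : Irrational θ)
    (h : HasBoundedCoefficients θ) : IsBadlyApproximable θ := by
  obtain ⟨M, hM⟩ := h
  set M' := max M 1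
  have hM1 : 1 ≤ M' := le_max_right _ _
  refine ⟨min (1 / 2) (1 / (M' + 2)), by positivity, fun r => ?_⟩
  have hq : (0 : ℝ) < r.den := by exact_mod_cast r.den_pos
  by_cases hr : |θ - r| < 1 / (2 * (r.den : ℝ) ^ 2)
  · obtain ⟨n, hn⟩ := Real.exists_convs_eq_rat hr
    obtain ⟨A, B, hA, hB⟩ := exists_int_nums_dens_eq θ n
    obtain ⟨A', B', hA', hB'⟩ := exists_int_nums_dens_eq θ (n + 1)
    have hB1 := one_le_dens_of_irrational hθ n
    rw [hB] at hB1
    have hdet := SimpContFract.determinant (s := SimpContFract.of θ) (n := n)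
      (not_terminatedAt_of_irrational hθ n)
    change (GenContFract.of θ).nums n * (GenContFract.of θ).dens (n + 1) -
      (GenContFract.of θ).dens n * (GenContFract.of θ).nums (n + 1) = (-1) ^ (n + 1) at hdet
    rw [hA, hB, hA', hB'] at hdet
    have hdet' : A * B' - B * A' = (-1) ^ (n + 1) := by exact_mod_cast hdet
    have hcop : IsCoprime B A := by
      refine ⟨-A' * (-1) ^ (n + 1), B' * (-1) ^ (n + 1), ?_⟩
      have hsq : ((-1 : ℤ) ^ (n + 1)) * (-1) ^ (n + 1) = 1 := by
        rw [← mul_pow]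
        simp
      linear_combination (-1 : ℤ) ^ (n + 1) * hdet' + hsq
    have hBden : (B : ℝ) ≤ r.den := by
      have hnum : (r : ℝ) * r.den = r.num := by exact_mod_cast Rat.mul_den_eq_num r
      have h1 : (A : ℝ) * r.den = B * r.num := by
        rw [← hnum, ← hn, conv_eq_num_div_den, hA, hB]
        field_simp
      have h2 : A * (r.den : ℤ) = B * r.num := by exact_mod_cast h1
      have h3 : B ∣ (r.den : ℤ) := hcop.dvd_of_dvd_mul_left ⟨_, h2⟩
      have h4 := Int.le_of_dvd (by exact_mod_cast r.den_pos) h3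
      exact_mod_cast h4
    have hnt := not_terminatedAt_of_irrational hθ n
    rw [of_terminatedAt_n_iff_succ_nth_intFractPair_stream_eq_none] at hnt
    obtain ⟨ifp', hifp'⟩ := Option.ne_none_iff_exists'.mp hnt
    obtain ⟨ifp, hifp, hfr, rfl⟩ := IntFractPair.succ_nth_stream_eq_some_iff.mp hifp'
    have hb : (GenContFract.of θ).partDens.get? n = some ((⌊ifp.fr⁻¹⌋ : ℤ) : ℝ) :=
      partDen_eq_s_b (get?_of_eq_some_of_succ_get?_intFractPair_stream hifp')
    have hbM : (⌊ifp.fr⁻¹⌋ : ℝ) ≤ M' := (hM n _ hb).trans (le_max_left _ _)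
    have hfrM : ifp.fr⁻¹ < M' + 1 := (Int.lt_floor_add_one _).trans_le (by linarith)
    have hfr0 : 0 ≤ ifp.fr⁻¹ := inv_nonneg.mpr (IntFractPair.nth_stream_fr_nonneg hifp)
    have hsub := sub_convs_eq hifp
    simp only [hfr, if_false] at hsub
    have hBeq : ((GenContFract.of θ).contsAux (n + 1)).b = B := by
      rw [← hB, den_eq_conts_b, nth_cont_eq_succ_nth_contAux]
    have hpB : ((GenContFract.of θ).contsAux n).b ≤ B := by
      cases n with
      | zero =>
        rw [zeroth_contAux_eq_one_zero]
        simp only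
        linarith
      | succ m =>
        rw [← hB, ← nth_cont_eq_succ_nth_contAux, ← den_eq_conts_b]
        exact of_den_mono
    have hpB0 : 0 ≤ ((GenContFract.of θ).contsAux n).b := zero_le_of_contsAux_b
    rw [hBeq, hn] at hsub
    have hfrpos : 0 < ifp.fr⁻¹ := lt_of_le_of_ne hfr0 (Ne.symm (inv_ne_zero hfr))
    have hden : 0 < (B : ℝ) * (ifp.fr⁻¹ * B + ((GenContFract.of θ).contsAux n).b) := by positivity
    rw [hsub, abs_div, abs_pow, abs_neg, abs_one, one_pow, abs_of_pos hden]
    calc min (1 / 2) (1 / (M' + 2)) / (r.den : ℝ) ^ 2 ≤ (1 / (M' + 2)) / (r.den : ℝ) ^ 2 := by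
          gcongr
          exact min_le_right _ _
      _ = 1 / ((M' + 2) * (r.den : ℝ) ^ 2) := by rw [div_div]
      _ ≤ _ := by
          refine one_div_le_one_div_of_le hden ?_
          calc (B : ℝ) * (ifp.fr⁻¹ * B + ((GenContFract.of θ).contsAux n).b)
              ≤ B * ((M' + 1) * B + B) := by gcongr
            _ = (M' + 2) * (B : ℝ) ^ 2 := by ring
            _ ≤ _ := by gcongr
  · rw [not_lt] at hr
    refine le_trans ?_ hr
    calc min (1 / 2) (1 / (M' + 2)) / (r.den : ℝ) ^ 2 ≤ (1 / 2) / (r.den : ℝ) ^ 2 := by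
          gcongr
          exact min_le_left _ _
      _ = _ := by rw [div_div]

end ContinuedFractions

end ConnesSubshift

end

theorem mainTheorem6 (θ : ℝ) (hθ : Irrational θ) (δ : ℝ → ℝ)
    (hδ : ConnesSubshift.IsLengthFunction δ)
    (hδ' : ConnesSubshift.SatisfiesMultiplicativeInequalities δ) :
    List.TFAE [
      ConnesSubshift.IsLinearlyRepetitive (ConnesSubshift.sturmianSubshift θ),
      ConnesSubshift.HasBoundedCoefficients θ,
      ConnesSubshift.LipschitzEquivalent
        (ConnesSubshift.dInf (ConnesSubshift.sturmianSubshift θ) δ)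
        (ConnesSubshift.dSup (ConnesSubshift.sturmianSubshift θ) δ)] := by
  tfae_have 1 → 3 := fun h => h.lipschitzEquivalent (ConnesSubshift.mechanicalWord_mem θ 0)
    (ConnesSubshift.mechanicalWord_not_periodic hθ 0) hδ hδ'
  tfae_have 3 → 2 := fun h => ConnesSubshift.hasBoundedCoefficients_of_isBadlyApproximable hθ
    (ConnesSubshift.isBadlyApproximable_of_lipschitzEquivalent hθ hδ hδ'.2 h)
  tfae_have 2 → 1 := fun h => (h.isBadlyApproximable hθ).isLinearlyRepetitive
  tfae_finish
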